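/- Let $D\in\mathbb N$ and $\tau,\lambda>0$. Let $\mathcal F(\mathbb R^D)$ be the set of finite boxes $X=\prod_{d=1}^D[a_d,b_d]$ with $a_d<b_d$, and put $L_d=b_d-a_d$. **Spaces.** For $X\in\mathcal F(\mathbb R^D)$ let $\Omega_X$ be the set of finite sequences $(\Box_1,m_1),\dots,(\Box_K,m_K)$, $K\ge 0$, where each bounding box $\Box_k=\prod_d[s_k^{(d)},v_k^{(d)}]$ is a nonempty closed box contained in $X$ and each cost $m_k$ is positive, with its Borel $\sigma$-algebra $\mathcal B_X$ (a set is measurable if for every $K$ its sequences of length $K$ form a Borel set of $K$-tuples). The arrival times are $t_k=m_1+\dots+m_k$. **The Rectangular Bounding Process.** $P^X$ is the law on $(\Omega_X,\mathcal B_X)$ of the following random sequence. (1) The number $K$ of boxes is Poisson with mean $\tau\prod_{d}(1+\lambda L_d)$. (2) Given $K$, the boxes are i.i.d. with independent dimensions. In dimension $d$ the initial position is $a_d+s$, where $s=0$ with probability $\frac1{1+\lambda L_d}$ and $s$ is uniform on $(0,L_d]$ with probability $\frac{\lambda L_d}{1+\lambda L_d}$. Given $s$, the length $l$ is $L_d-s$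 with probability $e^{-\lambda(L_d-s)}$, and otherwise has the exponential distribution of rate $\lambda$ truncated at $L_d-s$; the side is $[a_d+s,a_d+s+l]$. (3) Given $K$ and independently of the boxes, $K$ i.i.d. uniform points of $(0,\tau]$ are put in increasing order $t_1<\dots<t_K$, and $m_k=t_k-t_{k-1}$ with $t_0=0$. **Restriction.** For $X\subseteq Y$ in $\mathcal F(\mathbb R^D)$ the projection $\pi_{Y,X}:\Omega_Y\to\Omega_X$ removes the boxes that do not meet $X$, replaces every other box $\Box$ by $\Box\cap X$, and leaves the order and the arrival times of the remaining boxes unchanged (the costs become the differences of their consecutive arrival times). Let $$\Omega_{\mathbb R^D}=\Big\{(\omega_X)_{X}\in\prod_{X\in\mathcal F(\mathbb R^D)}\Omega_X:\ \pi_{Y,X}(\omega_Y)=\omega_X\text{ whenever }X\subseteq Y\Big\}$$ be the projective limit, with canonical projections $\pi_X(\omega)=\omega_X$ and with the smallest $\sigma$-algebra $\mathcal B_{\mathbb R^D}$ that makes all $\pi_X$ measurable. **Theorem.** The measures $P^X$, $X\in\mathcal F(\mathbb R^D)$, extend uniquely to the projective limit: there is exactly one probability measure $P^{\mathbb R^D}$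 on $(\Omega_{\mathbb R^D},\mathcal B_{\mathbb R^D})$ such that the image of $P^{\mathbb R^D}$ under $\pi_X$ is $P^X$ for every $X\in\mathcal F(\mathbb R^D)$. -/

import Mathlib

open MeasureTheory ProbabilityTheory

namespace RBP

/-- The Borel structure on finite sequences: a set of sequences is measurable when, for every `n`,
the set of its members of length `n` is measurable as a set of `n`-tuples. -/
instance instMeasurableSpaceList {α : Type*} [MeasurableSpace α] : MeasurableSpace (List α) :=
  MeasurableSpace.comap List.equivSigmaTuple Sigma.instMeasurableSpace

/-- A bounding box `∏_d [s_d, v_d]`, given by the pairs `(s_d, v_d)` of the initial and the terminal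
position in each dimension, in the coordinates of `ℝ^D`. -/
abbrev BoundingBox (D : ℕ) : Type := Fin D → ℝ × ℝ

/-- A bounding box together with its cost. -/
abbrev MarkedBox (D : ℕ) : Type := BoundingBox D × ℝ

/-! ### The spaces of partitions

The finite boxes of `ℝ^D` are the terms `X : BoxIntegral.Box (Fin D)`: they are given by two corners
with `X.lower d < X.upper d` for all `d`, and `X ≤ Y` means that `X` is contained in `Y`. -/

/-- A marked box in the domain `X`: the (closed, nonempty) bounding box lies in the closed box with the
corners of `X`, and the cost is positive. -/
def IsIn {D : ℕ} (X : BoxIntegral.Box (Fin D)) (p : MarkedBox D) : Prop :=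
  (∀ d, X.lower d ≤ (p.1 d).1 ∧ (p.1 d).1 ≤ (p.1 d).2 ∧ (p.1 d).2 ≤ X.upper d) ∧ 0 < p.2

/-- `Ω_X`: the partitions of `X`, finite sequences `(□_1, m_1), …, (□_K, m_K)` of bounding boxes
in `X` with positive costs. The box `□_k` arrives at time `t_k = m_1 + ⋯ + m_k`. The σ-algebra is the
one induced from finite sequences of marked boxes. -/
abbrev Partition {D : ℕ} (X : BoxIntegral.Box (Fin D)) : Type :=
  {ω : List (MarkedBox D) // ∀ p ∈ ω, IsIn X p}

/-! ### The generative process -/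

/-- The law of the initial position in an interval of length `L`, relative to its left end: `0` with
probability `1 / (1 + lam L)`, uniform on `(0, L]` with probability `lam L / (1 + lam L)`. -/
noncomputable def startLaw (lam L : ℝ) : Measure ℝ :=
  ENNReal.ofReal (1 / (1 + lam * L)) • Measure.dirac 0 +
    ENNReal.ofReal (lam * L / (1 + lam * L)) • cond volume (Set.Ioc 0 L)

/-- The law of the length, when `r` is the distance from the initial position to the right end: `r`
with probability `exp (-lam r)`, and with the remaining probability exponential of rate `lam`
truncated at `r`. -/
noncomputable def lengthLaw (lam r : ℝ) : Measure ℝ :=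
  ENNReal.ofReal (Real.exp (-(lam * r))) • Measure.dirac r +
    ENNReal.ofReal (1 - Real.exp (-(lam * r))) • cond (expMeasure lam) (Set.Iic r)

/-- The law of the pair (initial position, terminal position) in the interval `[a, b]`. -/
noncomputable def sideLaw (lam a b : ℝ) : Measure (ℝ × ℝ) :=
  (startLaw lam (b - a)).bind fun s =>
    (lengthLaw lam (b - a - s)).map fun l => (a + s, a + s + l)

/-- The law of one bounding box in `X`: the dimensions are independent. -/
noncomputable def boxLaw {D : ℕ} (lam : ℝ) (X : BoxIntegral.Box (Fin D)) :
    Measure (BoundingBox D) :=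
  Measure.pi fun d => sideLaw lam (X.lower d) (X.upper d)

/-- The law of `n` i.i.d. uniform points of `(0, τ]`, put in increasing order. -/
noncomputable def timeLaw (τ : ℝ) (n : ℕ) : Measure (Fin n → ℝ) :=
  (Measure.pi fun _ : Fin n => cond volume (Set.Ioc 0 τ)).map fun t => t ∘ Tuple.sort t

/-- The sequence of boxes `B_k` with costs `t_k - t_{k-1}`, where `t_0 = 0`. -/
def assemble {D n : ℕ} (B : Fin n → BoundingBox D) (t : Fin n → ℝ) : List (MarkedBox D) :=
  List.ofFn fun k => (B k, t k - (Fin.cons 0 t : Fin (n + 1) → ℝ) k.castSucc)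

/-- The law of the sequence of marked boxes produced by the generative process on `X` with budget `τ`
and length parameter `lam`: the number of boxes is Poisson of mean `τ ∏_d (1 + lam L_d)`; given it, the
boxes are i.i.d. and independent of the times. -/
noncomputable def seqLaw {D : ℕ} (τ lam : ℝ) (X : BoxIntegral.Box (Fin D)) :
    Measure (List (MarkedBox D)) :=
  (poissonMeasure (Real.toNNReal (τ * ∏ d, (1 + lam * (X.upper d - X.lower d))))).bind fun n =>
    ((Measure.pi fun _ : Fin n => boxLaw lam X).prod (timeLaw τ n)).map fun p => assemble p.1 p.2

/-- `P^X`: the law of `RBP(X, τ, lam)` as a measure on `Ω_X`. The generated sequence lies in `Ω_X` with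
probability one (ties between times have probability zero). -/
noncomputable def law {D : ℕ} (τ lam : ℝ) (X : BoxIntegral.Box (Fin D)) : Measure (Partition X) :=
  (seqLaw τ lam X).comap Subtype.val

/-! ### Restriction to a subdomain and the projective limit -/

/-- The intersection of a bounding box with (the closed box) `X`. -/
def clip {D : ℕ} (X : BoxIntegral.Box (Fin D)) (B : BoundingBox D) : BoundingBox D :=
  fun d => (max (B d).1 (X.lower d), min (B d).2 (X.upper d))

/-- The intersection of the bounding box with (the closed box) `X` is nonempty. -/
def Meets {D : ℕ} (X : BoxIntegral.Box (Fin D)) (B : BoundingBox D) : Prop :=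
  ∀ d, (clip X B d).1 ≤ (clip X B d).2

open Classical in
/-- Restrict a sequence of marked boxes to `X`: the boxes that meet `X` are kept, in their order and
with unchanged arrival times, and are intersected with `X`; the others are removed. The cost of a box
being the time elapsed since its predecessor, the costs of removed boxes are added to that of the next
box kept; `c` is the total cost of the boxes removed since the last one kept. -/
noncomputable def restrictList {D : ℕ} (X : BoxIntegral.Box (Fin D)) :
    ℝ → List (MarkedBox D) → List (MarkedBox D)
  | _, [] => []
  | c, p :: ω =>
    if Meets X p.1 then (clip X p.1, c + p.2) :: restrictList X 0 ω
    else restrictList X (c + p.2) ω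

theorem isIn_of_mem_restrictList {D : ℕ} (X : BoxIntegral.Box (Fin D)) (ω : List (MarkedBox D))
    (hω : ∀ p ∈ ω, 0 < p.2 ∧ ∀ d, (p.1 d).1 ≤ (p.1 d).2) (c : ℝ) (hc : 0 ≤ c) :
    ∀ q ∈ restrictList X c ω, IsIn X q := by
  induction ω generalizing c with
  | nil => simp [restrictList]
  | cons p ω ih =>
    have hp := hω p (by simp)
    have hω' : ∀ p ∈ ω, 0 < p.2 ∧ ∀ d, (p.1 d).1 ≤ (p.1 d).2 :=
      fun q hq => hω q (by simp [hq])
    intro q hq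
    rw [restrictList] at hq
    split_ifs at hq with h
    · rcases List.mem_cons.1 hq with rfl | hq
      · exact ⟨fun d => ⟨le_max_right _ _, h d, min_le_right _ _⟩, by
          have := hp.1
          simp only
          linarith⟩
      · exact ih hω' 0 le_rfl q hq
    · exact ih hω' (c + p.2) (by linarith [hp.1]) q hq

/-- The projection `π_{Y,X} : Ω_Y → Ω_X` restricting a partition of `Y` to `X` (used for `X ≤ Y`). -/
noncomputable def restrict {D : ℕ} (Y X : BoxIntegral.Box (Fin D)) (ω : Partition Y) :
    Partition X :=
  ⟨restrictList X 0 ω.1, isIn_of_mem_restrictList X ω.1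
    (fun p hp => ⟨(ω.2 p hp).2, fun d => ((ω.2 p hp).1 d).2.1⟩) 0 le_rfl⟩

/-- `Ω_{ℝ^D}`: the projective limit of the spaces `Ω_X` along the projections `π_{Y,X}`, `X ≤ Y`. Its
σ-algebra is the one induced from the product, the smallest that makes all `ω ↦ ω_X` measurable. -/
abbrev Limit (D : ℕ) : Type :=
  {ω : ∀ X : BoxIntegral.Box (Fin D), Partition X //
    ∀ X Y : BoxIntegral.Box (Fin D), X ≤ Y → restrict Y X (ω Y) = ω X}

/-- The canonical projection `Ω_{ℝ^D} → Ω_X`. -/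
def proj {D : ℕ} (X : BoxIntegral.Box (Fin D)) (ω : Limit D) : Partition X := ω.1 X

end RBP

/-!
The laws `P^X` extend uniquely to the projective limit because they form a projective family of
probability measures on standard Borel spaces and because the cubes `[-(n + 1), n + 1]^D` form a
cofinal sequence of domains.

*Consistency* (`map_restrict_law`). Let `X ⊆ Y`. In one dimension, up to the factor `1 + lam L`, a
side has an initial position with an atom of mass `1` at the left end and density `lam` beyond it,
and an exponential length stopped at the right end. The exponential distribution has no memory, so
the sides that start to the left of `X` and reach it have again total mass `1` and continue with an
exponential length: restricting a side of `Y` to `X` gives a side of `X`, up to the ratio of the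
factors (`map_clip_sideLaw`), and the same holds for boxes by independence (`map_clip_boxLaw`). As
the boxes are exchangeable, attaching them to sorted times is the same as sorting independent pairs
of a box and a time (`map_assemble_eq_map_iidList`), so the generated sequence is a sorted Poisson
number of independent pairs. Sorting commutes with the removal of pairs (`thin_byTime`), in terms of
arrival times `π_{Y,X}` is such a removal followed by an intersection with `X`
(`restrictList_costs`), and by the thinning property of Poisson processes (`map_thin_poissonList`)
the remaining pairs are again a Poisson number of independent pairs. The mean numbers match, since
`τ ∏ (1 + lam L_d)` times the probability of meeting `X` is the mean number for `X`.

*Extension* (`exists_measure_limit`). Along the cubes, a Markov chain whose transition kernels are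
conditional laws, given by the Ionescu-Tulcea theorem, has the prescribed marginals and is almost
surely consistent under restriction (`exists_measure_of_consistent`). A consistent sequence
determines a point of the limit by restriction to arbitrary boxes.

*Uniqueness* (`ext_of_map_proj`). The domains are directed, so the events that depend on a single
domain form a π-system that generates the σ-algebra of the limit.
-/

namespace RBP

/-! ### Measurable structure of the space of finite sequences -/

section ListMeasurable

variable {α β γ : Type*} [MeasurableSpace α] [MeasurableSpace β] [MeasurableSpace γ]

theorem measurableSet_list_iff {s : Set (List α)} :
    MeasurableSet s ↔ ∀ n, MeasurableSet ((List.ofFn : (Fin n → α) → List α) ⁻¹' s) := by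
  have key : ∀ t : Set (Σ n, Fin n → α),
      MeasurableSet t ↔ ∀ n, MeasurableSet {v : Fin n → α | (⟨n, v⟩ : Σ n, Fin n → α) ∈ t} :=
    fun t =>
    MeasurableSpace.measurableSet_iInf
  constructor
  · rintro ⟨t, ht, rfl⟩ n
    have h := (key t).1 ht n
    have : (List.ofFn : (Fin n → α) → List α) ⁻¹' (List.equivSigmaTuple ⁻¹' t)
        = {v : Fin n → α | (⟨n, v⟩ : Σ n, Fin n → α) ∈ t} := by
      ext v
      have := List.equivSigmaTuple.right_inv (⟨n, v⟩ : Σ n, Fin n → α)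
      exact iff_of_eq (congrArg (· ∈ t) this)
    rw [this]
    exact h
  · intro h
    refine ⟨List.equivSigmaTuple.symm ⁻¹' s, (key _).2 h, ?_⟩
    ext l
    simp

theorem measurable_ofFn (n : ℕ) : Measurable (List.ofFn : (Fin n → α) → List α) :=
  fun _ hs => measurableSet_list_iff.1 hs n

theorem measurable_of_comp_ofFn {f : List α → β}
    (h : ∀ n, Measurable fun v : Fin n → α => f (List.ofFn v)) : Measurable f :=
  fun _ hs => measurableSet_list_iff.2 fun n => h n hs

theorem measurable_getD (i : ℕ) (d : α) : Measurable fun l : List α => l.getD i d := by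
  refine measurable_of_comp_ofFn fun n => ?_
  by_cases h : i < n
  · have : (fun v : Fin n → α => (List.ofFn v).getD i d) = fun v => v ⟨i, h⟩ := by
      ext v; simp [h]
    rw [this]
    exact measurable_pi_apply _
  · have : (fun v : Fin n → α => (List.ofFn v).getD i d) = fun _ => d := by
      ext v; simp [h]
    rw [this]
    exact measurable_const

theorem measurable_length : Measurable (List.length : List α → ℕ) :=
  measurable_of_comp_ofFn fun n => by simp

/-- A function of a parameter and a sequence is measurable if it is so on tuples of each length. -/
theorem measurable_prod_of_comp_ofFn {f : γ × List α → β}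
    (h : ∀ n, Measurable fun p : γ × (Fin n → α) => f (p.1, List.ofFn p.2)) : Measurable f := by
  rcases isEmpty_or_nonempty α with hα | ⟨⟨d⟩⟩
  · have hf : f = (fun c => f (c, [])) ∘ Prod.fst := by
      ext ⟨c, l⟩
      cases l with
      | nil => rfl
      | cons a _ => exact isEmptyElim a
    rw [hf]
    have h0 : Measurable fun c : γ => (c, (fun i => i.elim0 : Fin 0 → α)) := by fun_prop
    exact ((h 0).comp h0).comp measurable_fst
  intro s hs
  have : f ⁻¹' s = ⋃ n, {p : γ × List α | p.2.length = n} ∩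
      (fun p : γ × List α => (p.1, fun i : Fin n => p.2.getD i d)) ⁻¹'
        ((fun p : γ × (Fin n → α) => f (p.1, List.ofFn p.2)) ⁻¹' s) := by
    ext ⟨c, l⟩
    have hl : (List.ofFn fun i : Fin l.length => l.getD i d) = l := by
      conv_rhs => rw [← List.ofFn_get l]
      congr 1
      ext i
      simp
    simp only [Set.mem_preimage, Set.mem_iUnion, Set.mem_inter_iff, Set.mem_ofPred_eq]
    refine ⟨fun h => ⟨l.length, rfl, by rwa [hl]⟩, ?_⟩
    rintro ⟨_, rfl, h⟩
    rwa [hl] at h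
  rw [this]
  refine MeasurableSet.iUnion fun n => MeasurableSet.inter ?_ ?_
  · exact (measurable_length.comp measurable_snd) (measurableSet_singleton n)
  · refine Measurable.prodMk measurable_fst ?_ (h n hs)
    exact measurable_pi_lambda _ fun i => (measurable_getD i.1 d).comp measurable_snd

theorem measurable_cons : Measurable fun p : α × List α => p.1 :: p.2 := by
  refine measurable_prod_of_comp_ofFn fun n => ?_
  have : (fun p : α × (Fin n → α) => p.1 :: List.ofFn p.2) =
      fun p => List.ofFn (Fin.cons p.1 p.2 : Fin (n + 1) → α) := by
    ext1 p; simp [List.ofFn_succ]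
  simp only [this]
  refine (measurable_ofFn _).comp (measurable_pi_lambda _ fun i => ?_)
  refine Fin.cases ?_ (fun i => ?_) i
  · simpa using measurable_fst
  · simp only [Fin.cons_succ]
    fun_prop

/-- Joint measurability of a function of a parameter and a sequence, by recursion on the sequence:
the induction step may use the measurability on tuples that are shorter by one. -/
theorem measurable_prod_list_rec {f : γ → List α → β} (h0 : Measurable fun c => f c [])
    (hs : ∀ n, (Measurable fun p : γ × (Fin n → α) => f p.1 (List.ofFn p.2)) →
      Measurable fun p : γ × α × (Fin n → α) => f p.1 (p.2.1 :: List.ofFn p.2.2)) :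
    Measurable fun p : γ × List α => f p.1 p.2 := by
  refine measurable_prod_of_comp_ofFn fun n => ?_
  induction n with
  | zero =>
    simp only [List.ofFn_zero]
    exact h0.comp measurable_fst
  | succ n ih =>
    have hm : Measurable fun p : γ × (Fin (n + 1) → α) =>
        (p.1, p.2 0, fun i : Fin n => p.2 i.succ) := by
      fun_prop
    simpa [List.ofFn_succ, Function.comp_def] using (hs n ih).comp hm

theorem measurable_list_rec {f : List α → β}
    (hs : ∀ n, (Measurable fun v : Fin n → α => f (List.ofFn v)) →
      Measurable fun p : α × (Fin n → α) => f (p.1 :: List.ofFn p.2)) :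
    Measurable f := by
  refine measurable_of_comp_ofFn fun n => ?_
  induction n with
  | zero => simp
  | succ n ih =>
    have hm : Measurable fun v : Fin (n + 1) → α => (v 0, fun i : Fin n => v i.succ) := by
      fun_prop
    simpa [List.ofFn_succ, Function.comp_def] using (hs n ih).comp hm

theorem measurableSet_forall_mem {s : Set α} (hs : MeasurableSet s) :
    MeasurableSet {l : List α | ∀ a ∈ l, a ∈ s} := by
  refine measurableSet_list_iff.2 fun n => ?_
  have : (List.ofFn : (Fin n → α) → List α) ⁻¹' {l | ∀ a ∈ l, a ∈ s} =
      ⋂ i, {v | v i ∈ s} := by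
    ext v; simp
  rw [this]
  exact MeasurableSet.iInter fun i => measurable_pi_apply i hs

/-- Finite sequences in a standard Borel space form a standard Borel space: the length and the
sequence padded with a constant identify them with a measurable part of `ℕ × (ℕ → α)`. -/
theorem standardBorelSpace_list [StandardBorelSpace α] [Nonempty α] :
    StandardBorelSpace (List α) := by
  obtain ⟨d⟩ := ‹Nonempty α›
  let s : Set (ℕ × (ℕ → α)) := ⋂ i, {p | p.1 ≤ i → p.2 i = d}
  have hsm : MeasurableSet s := by
    refine MeasurableSet.iInter fun i => ?_
    have : {p : ℕ × (ℕ → α) | p.1 ≤ i → p.2 i = d} =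
        {p | p.1 ≤ i}ᶜ ∪ {p | p.2 i = d} := by
      ext p; simp [imp_iff_not_or]
    rw [this]
    refine ((measurable_fst (measurableSet_Iic (a := i))).compl).union ?_
    have hi : Measurable fun p : ℕ × (ℕ → α) => p.2 i := by fun_prop
    exact hi (measurableSet_singleton d)
  have hstd : StandardBorelSpace s := hsm.standardBorel
  let e : List α ≃ s :=
    { toFun := fun l => ⟨(l.length, fun i => l.getD i d), by
        simp only [s, Set.mem_iInter]
        intro i hi
        exact List.getD_eq_default _ _ hi⟩
      invFun := fun p => List.ofFn fun i : Fin p.1.1 => p.1.2 i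
      left_inv := fun l => by
        conv_rhs => rw [← List.ofFn_get l]
        simp
      right_inv := fun ⟨⟨n, f⟩, hp⟩ => by
        simp only [s, Set.mem_iInter] at hp
        ext i
        · simp
        · by_cases hi : i < n
          · simp [hi]
          · simpa [hi] using (hp i (not_lt.1 hi)).symm }
  have he : Measurable e := by
    refine Measurable.subtype_mk (measurable_length.prodMk ?_)
    exact measurable_pi_lambda _ fun i => measurable_getD i d
  have he' : Measurable e.symm := by
    have : ∀ n : ℕ, Measurable fun f : ℕ → α => List.ofFn fun i : Fin n => f i := fun n =>
      (measurable_ofFn n).comp (by fun_prop)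
    exact (measurable_from_prod_countable_right
      (f := fun p : ℕ × (ℕ → α) => List.ofFn fun i : Fin p.1 => p.2 i) this).comp
      measurable_subtype_coe
  let _ := upgradeStandardBorel s
  let t : TopologicalSpace (List α) := TopologicalSpace.induced e inferInstance
  have hP : PolishSpace (List α) := e.polishSpace_induced
  refine ⟨t, ⟨?_⟩, hP⟩
  have hb : borel (List α) = MeasurableSpace.comap e inferInstance := by
    rw [eq_borel_upgradeStandardBorel s, borel_comap]
  rw [hb]
  refine le_antisymm ?_ he.comap_le
  intro u hu
  exact ⟨e.symm ⁻¹' u, he' hu, by ext; simp⟩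

end ListMeasurable

/-! ### Thinning a Poisson number of independent points -/

section Thinning

open scoped NNReal ENNReal

variable {α β : Type*}

open Classical in
/-- Keep the members of a sequence that lie in `s`, and apply `φ` to them. -/
noncomputable def thin (s : Set α) (φ : α → β) (l : List α) : List β :=
  l.filterMap fun a => if a ∈ s then some (φ a) else none

theorem thin_nil (s : Set α) (φ : α → β) : thin s φ [] = [] := rfl

theorem thin_cons_of_mem {s : Set α} {a : α} (h : a ∈ s) (φ : α → β) (l : List α) :
    thin s φ (a :: l) = φ a :: thin s φ l := by
  simp [thin, h]

theorem thin_cons_of_notMem {s : Set α} {a : α} (h : a ∉ s) (φ : α → β) (l : List α) :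
    thin s φ (a :: l) = thin s φ l := by
  simp [thin, h]

variable [MeasurableSpace α] [MeasurableSpace β]

/-- The law of a sequence of `n` independent points with law `μ`. -/
noncomputable def iidList (μ : Measure α) (n : ℕ) : Measure (List α) :=
  (Measure.pi fun _ : Fin n => μ).map List.ofFn

instance isProbabilityMeasure_iidList (μ : Measure α) [IsProbabilityMeasure μ] (n : ℕ) :
    IsProbabilityMeasure (iidList μ n) :=
  Measure.isProbabilityMeasure_map (measurable_ofFn n).aemeasurable

theorem lintegral_iidList_zero (μ : Measure α) [SigmaFinite μ] {f : List α → ℝ≥0∞}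
    (hf : Measurable f) : ∫⁻ l, f l ∂iidList μ 0 = f [] := by
  rw [iidList, lintegral_map hf (measurable_ofFn 0), Measure.pi_of_empty, lintegral_dirac]
  simp

theorem lintegral_iidList_succ (μ : Measure α) [SigmaFinite μ] (n : ℕ) {f : List α → ℝ≥0∞}
    (hf : Measurable f) :
    ∫⁻ l, f l ∂iidList μ (n + 1) = ∫⁻ a, ∫⁻ l, f (a :: l) ∂iidList μ n ∂μ := by
  have hm := measurePreserving_piFinSuccAbove (fun _ : Fin (n + 1) => μ) 0
  rw [iidList, lintegral_map hf (measurable_ofFn _)]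
  have h1 : ∀ v : Fin (n + 1) → α, f (List.ofFn v) =
      (fun p : α × (Fin n → α) => f (p.1 :: List.ofFn p.2))
        (MeasurableEquiv.piFinSuccAbove (fun _ => α) 0 v) := fun v => by
    simp [List.ofFn_succ, MeasurableEquiv.piFinSuccAbove, Fin.insertNthEquiv, Fin.tail_def]
  have h2 : Measurable fun p : α × (Fin n → α) => f (p.1 :: List.ofFn p.2) :=
    hf.comp (measurable_cons.comp
      (measurable_fst.prodMk ((measurable_ofFn n).comp measurable_snd)))
  simp only [h1]
  rw [hm.lintegral_comp h2, lintegral_prod _ h2.aemeasurable]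
  refine lintegral_congr fun a => ?_
  rw [iidList, lintegral_map (f := fun l => f (a :: l))
    (hf.comp (measurable_cons.comp measurable_prodMk_left)) (measurable_ofFn n)]

theorem measurable_lintegral_cons (ν : Measure (List α)) [SFinite ν] {f : List α → ℝ≥0∞}
    (hf : Measurable f) : Measurable fun a => ∫⁻ l, f (a :: l) ∂ν :=
  (hf.comp measurable_cons).lintegral_prod_right'

theorem measurable_thin {s : Set α} (hs : MeasurableSet s) {φ : α → β} (hφ : Measurable φ) :
    Measurable (thin s φ) := by
  classical
  refine measurable_list_rec fun n ih => ?_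
  have : (fun p : α × (Fin n → α) => thin s φ (p.1 :: List.ofFn p.2)) = fun p =>
      if p.1 ∈ s then φ p.1 :: thin s φ (List.ofFn p.2) else thin s φ (List.ofFn p.2) := by
    ext1 p
    split_ifs with h
    · exact thin_cons_of_mem h _ _
    · exact thin_cons_of_notMem h _ _
  rw [this]
  refine Measurable.ite (measurable_fst hs) ?_ (ih.comp measurable_snd)
  exact measurable_cons.comp ((hφ.comp measurable_fst).prodMk (ih.comp measurable_snd))

/-- Among `n` independent points the number of those kept is binomial, and given it they are
independent. -/
theorem lintegral_iidList_thin {μ : Measure α} [IsProbabilityMeasure μ] {μ' : Measure β}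
    [IsProbabilityMeasure μ'] {s : Set α} (hs : MeasurableSet s) {φ : α → β} (hφ : Measurable φ)
    {p q : ℝ≥0} (hp : (μ.restrict s).map φ = p • μ') (hq : μ sᶜ = q) (n : ℕ) {f : List β → ℝ≥0∞}
    (hf : Measurable f) :
    ∫⁻ l, f (thin s φ l) ∂iidList μ n = ∑ k ∈ Finset.range (n + 1),
      (n.choose k : ℝ≥0∞) * (q : ℝ≥0∞) ^ (n - k) * (p : ℝ≥0∞) ^ k *
        ∫⁻ l, f l ∂iidList μ' k := by
  induction n generalizing f with
  | zero =>
    rw [lintegral_iidList_zero (f := fun l => f (thin s φ l)) _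
      (hf.comp (measurable_thin hs hφ))]
    simp [lintegral_iidList_zero _ hf, thin_nil]
  | succ n ih =>
    rw [lintegral_iidList_succ (f := fun l => f (thin s φ l)) _ n
      (hf.comp (measurable_thin hs hφ)),
      ← lintegral_add_compl _ hs]
    have hcons : ∀ b, Measurable fun l : List β => f (b :: l) := fun b =>
      hf.comp (measurable_cons.comp measurable_prodMk_left)
    have h1 : ∫⁻ a in s, ∫⁻ l, f (thin s φ (a :: l)) ∂iidList μ n ∂μ =
        ∑ k ∈ Finset.range (n + 1), (n.choose k : ℝ≥0∞) * (q : ℝ≥0∞) ^ (n - k) *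
          (p : ℝ≥0∞) ^ (k + 1) * ∫⁻ l, f l ∂iidList μ' (k + 1) := by
      have hg : Measurable fun b => ∑ k ∈ Finset.range (n + 1), (n.choose k : ℝ≥0∞) *
          (q : ℝ≥0∞) ^ (n - k) * (p : ℝ≥0∞) ^ k * ∫⁻ l, f (b :: l) ∂iidList μ' k :=
        Finset.measurable_sum _ fun k _ => (measurable_lintegral_cons _ hf).const_mul _
      calc ∫⁻ a in s, ∫⁻ l, f (thin s φ (a :: l)) ∂iidList μ n ∂μ
          = ∫⁻ a in s, ∑ k ∈ Finset.range (n + 1), (n.choose k : ℝ≥0∞) *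
              (q : ℝ≥0∞) ^ (n - k) * (p : ℝ≥0∞) ^ k *
                ∫⁻ l, f (φ a :: l) ∂iidList μ' k ∂μ := by
            refine setLIntegral_congr_fun hs fun a ha => ?_
            simp only [thin_cons_of_mem ha]
            exact ih (hcons _)
        _ = ∫⁻ b, ∑ k ∈ Finset.range (n + 1), (n.choose k : ℝ≥0∞) *
              (q : ℝ≥0∞) ^ (n - k) * (p : ℝ≥0∞) ^ k *
                ∫⁻ l, f (b :: l) ∂iidList μ' k ∂(p • μ') := by
            rw [← hp, lintegral_map hg hφ]
        _ = _ := by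
            rw [lintegral_smul_measure, lintegral_finsetSum _ fun k _ =>
              (measurable_lintegral_cons _ hf).const_mul _, ENNReal.smul_def, smul_eq_mul,
              Finset.mul_sum]
            refine Finset.sum_congr rfl fun k _ => ?_
            rw [lintegral_const_mul _ (measurable_lintegral_cons _ hf),
              lintegral_iidList_succ _ k hf]
            ring
    have h2 : ∫⁻ a in sᶜ, ∫⁻ l, f (thin s φ (a :: l)) ∂iidList μ n ∂μ =
        ∑ k ∈ Finset.range (n + 1), (n.choose k : ℝ≥0∞) * (q : ℝ≥0∞) ^ (n + 1 - k) *
          (p : ℝ≥0∞) ^ k * ∫⁻ l, f l ∂iidList μ' k := by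
      have : ∫⁻ a in sᶜ, ∫⁻ l, f (thin s φ (a :: l)) ∂iidList μ n ∂μ =
          ∫⁻ _ in sᶜ, ∫⁻ l, f (thin s φ l) ∂iidList μ n ∂μ :=
        setLIntegral_congr_fun hs.compl fun a ha => by simp only [thin_cons_of_notMem ha]
      rw [this, setLIntegral_const, hq, ih hf, Finset.sum_mul]
      refine Finset.sum_congr rfl fun k hk => ?_
      rw [Nat.succ_sub (Nat.lt_succ_iff.1 (Finset.mem_range.1 hk)), pow_succ]
      ring
    -- Pascal's rule, the terms `k + 1` and `0` being separated in each sum.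
    rw [h1, h2, Finset.sum_range_succ' _ (n + 1)]
    rw [Finset.sum_range_succ' (fun k => (n.choose k : ℝ≥0∞) * (q : ℝ≥0∞) ^ (n + 1 - k) *
      (p : ℝ≥0∞) ^ k * ∫⁻ l, f l ∂iidList μ' k) n]
    have h3 : ∑ k ∈ Finset.range n, (n.choose (k + 1) : ℝ≥0∞) * (q : ℝ≥0∞) ^ (n + 1 - (k + 1)) *
        (p : ℝ≥0∞) ^ (k + 1) * ∫⁻ l, f l ∂iidList μ' (k + 1) =
        ∑ k ∈ Finset.range (n + 1), (n.choose (k + 1) : ℝ≥0∞) *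
          (q : ℝ≥0∞) ^ (n + 1 - (k + 1)) *
          (p : ℝ≥0∞) ^ (k + 1) * ∫⁻ l, f l ∂iidList μ' (k + 1) := by
      rw [Finset.sum_range_succ]; simp
    rw [h3, ← add_assoc, ← Finset.sum_add_distrib]
    congr 1
    · refine Finset.sum_congr rfl fun k _ => ?_
      rw [Nat.choose_succ_succ, Nat.add_sub_add_right]
      push_cast
      ring
    · simp

/-- The law of a sequence of independent points with law `μ`, whose length is Poisson with
mean `r`. -/
noncomputable def poissonList (r : ℝ≥0) (μ : Measure α) : Measure (List α) :=
  (poissonMeasure r).bind (iidList μ)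

theorem lintegral_poissonList (r : ℝ≥0) (μ : Measure α) {f : List α → ℝ≥0∞} (hf : Measurable f) :
    ∫⁻ l, f l ∂poissonList r μ = ∑' n, poissonMeasure r {n} * ∫⁻ l, f l ∂iidList μ n := by
  rw [poissonList, Measure.lintegral_bind (Measurable.of_discrete).aemeasurable hf.aemeasurable,
    lintegral_countable']
  simp only [mul_comm]

/-- A binomial choice from a Poisson number makes the numbers `j` of removed and `k` of kept points
independent Poisson variables. -/
theorem poissonMeasure_singleton_add {r p q : ℝ≥0} (hpq : p + q = 1) (j k : ℕ) :
    poissonMeasure r {j + k} * (((j + k).choose k : ℝ≥0∞) * (q : ℝ≥0∞) ^ j * (p : ℝ≥0∞) ^ k) =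
      poissonMeasure (r * q) {j} * poissonMeasure (r * p) {k} := by
  simp only [poissonMeasure_singleton]
  have e1 : (((j + k).choose k : ℝ≥0∞) * (q : ℝ≥0∞) ^ j * (p : ℝ≥0∞) ^ k) =
      ENNReal.ofReal (((j + k).choose k : ℝ) * (q : ℝ) ^ j * (p : ℝ) ^ k) := by
    rw [ENNReal.ofReal_mul (by positivity), ENNReal.ofReal_mul (by positivity),
      ENNReal.ofReal_natCast, ENNReal.ofReal_pow (by positivity),
      ENNReal.ofReal_pow (by positivity),
      ENNReal.ofReal_coe_nnreal, ENNReal.ofReal_coe_nnreal]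
  rw [e1, ← ENNReal.ofReal_mul (by positivity), ← ENNReal.ofReal_mul (by positivity)]
  congr 1
  have hpq' : (q : ℝ) = 1 - p := by
    rw [eq_sub_iff_add_eq']; exact_mod_cast hpq
  have e2 : Real.exp (-(r : ℝ)) = Real.exp (-(r * q : ℝ)) * Real.exp (-(r * p : ℝ)) := by
    rw [← Real.exp_add]; congr 1; rw [hpq']; ring
  have e3 : ((j + k).choose k : ℝ) = ((j + k).factorial : ℝ) / (k.factorial * j.factorial) := by
    rw [Nat.cast_choose ℝ (Nat.le_add_left k j), Nat.add_sub_cancel]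
  rw [e2, e3]
  push_cast
  have := Nat.cast_ne_zero (R := ℝ).2 (Nat.factorial_ne_zero (j + k))
  field_simp
  ring

/-- The thinning property of Poisson processes. -/
theorem map_thin_poissonList {μ : Measure α} [IsProbabilityMeasure μ] {μ' : Measure β}
    [IsProbabilityMeasure μ'] {s : Set α} (hs : MeasurableSet s) {φ : α → β} (hφ : Measurable φ)
    {p q : ℝ≥0} (hp : (μ.restrict s).map φ = p • μ') (hq : μ sᶜ = q) (hpq : p + q = 1) (r : ℝ≥0) :
    (poissonList r μ).map (thin s φ) = poissonList (r * p) μ' := by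
  refine Measure.ext_of_lintegral _ fun f hf => ?_
  rw [lintegral_map hf (measurable_thin hs hφ),
    lintegral_poissonList (f := fun l => f (thin s φ l)) _ _
      (hf.comp (measurable_thin hs hφ)), lintegral_poissonList _ _ hf]
  set I : ℕ → ℝ≥0∞ := fun k => ∫⁻ l, f l ∂iidList μ' k
  calc ∑' n, poissonMeasure r {n} * ∫⁻ l, f (thin s φ l) ∂iidList μ n
      = ∑' n, ∑ jk ∈ Finset.HasAntidiagonal.antidiagonal n,
          poissonMeasure (r * q) {jk.1} * (poissonMeasure (r * p) {jk.2} * I jk.2) := by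
        refine tsum_congr fun n => ?_
        rw [lintegral_iidList_thin hs hφ hp hq n hf,
          ← Finset.Nat.sum_antidiagonal_swap, Finset.Nat.sum_antidiagonal_eq_sum_range_succ_mk,
          Finset.mul_sum]
        refine Finset.sum_congr rfl fun k hk => ?_
        obtain ⟨j, rfl⟩ := Nat.exists_eq_add_of_le' (Nat.lt_succ_iff.1 (Finset.mem_range.1 hk))
        simp only [Prod.swap, Nat.add_sub_cancel, I]
        rw [← mul_assoc (poissonMeasure (r * q) _), ← poissonMeasure_singleton_add hpq]
        ring
    _ = ∑' jk : ℕ × ℕ, poissonMeasure (r * q) {jk.1} *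
          (poissonMeasure (r * p) {jk.2} * I jk.2) := by
        rw [← Finset.HasAntidiagonal.sigmaAntidiagonalEquivProd.tsum_eq, ENNReal.tsum_sigma']
        refine tsum_congr fun n => ?_
        rw [tsum_fintype, ← Finset.sum_coe_sort]
        rfl
    _ = ∑' k, poissonMeasure (r * p) {k} * I k := by
        have h1 : ∑' j, poissonMeasure (r * q) {j} = 1 := by
          have := lintegral_countable' (μ := poissonMeasure (r * q)) fun _ => 1
          simpa using this.symm
        rw [ENNReal.tsum_prod (f := fun j k => poissonMeasure (r * q) {j} *
          (poissonMeasure (r * p) {k} * I k))]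
        simp only [ENNReal.tsum_mul_left, ENNReal.tsum_mul_right, h1, one_mul]

end Thinning

/-! ### The law of one side -/

section Side

open scoped NNReal ENNReal
open Set

variable {lam : ℝ}

theorem expMeasure_Iic (hlam : 0 < lam) {x : ℝ} (hx : 0 ≤ x) :
    expMeasure lam (Iic x) = ENNReal.ofReal (1 - Real.exp (-(lam * x))) := by
  have := isProbabilityMeasure_expMeasure hlam
  rw [← ofReal_cdf, cdf_expMeasure_eq hlam, if_pos hx]

theorem expMeasure_Ioi (hlam : 0 < lam) {x : ℝ} (hx : 0 ≤ x) :
    expMeasure lam (Ioi x) = ENNReal.ofReal (Real.exp (-(lam * x))) := by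
  have := isProbabilityMeasure_expMeasure hlam
  rw [← compl_Iic, prob_compl_eq_one_sub measurableSet_Iic, expMeasure_Iic hlam hx,
    ← ENNReal.ofReal_one, ← ENNReal.ofReal_sub _ (by
      rw [sub_nonneg, Real.exp_le_one_iff]; nlinarith)]
  congr 1; ring

theorem ae_expMeasure_pos (hlam : 0 < lam) : ∀ᵐ l ∂expMeasure lam, 0 < l := by
  have : expMeasure lam (Iic 0) = 0 := by
    rw [expMeasure_Iic hlam le_rfl]; simp
  rw [ae_iff]
  convert this using 2
  ext x; simp

/-- The exponential distribution has no memory. -/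
theorem setLIntegral_Ici_expMeasure {c : ℝ} (hc : 0 ≤ c) {h : ℝ → ℝ≥0∞} (hh : Measurable h) :
    ∫⁻ l in Ici c, h l ∂expMeasure lam =
      ENNReal.ofReal (Real.exp (-(lam * c))) * ∫⁻ l, h (l + c) ∂expMeasure lam := by
  have hpdf : Measurable (exponentialPDF lam) := (measurable_exponentialPDFReal lam).ennreal_ofReal
  have hh' : Measurable fun l => h (l + c) := by fun_prop
  have hE : expMeasure lam = volume.withDensity (exponentialPDF lam) := rfl
  rw [← lintegral_indicator measurableSet_Ici, hE,
    lintegral_withDensity_eq_lintegral_mul _ hpdf (hh.indicator measurableSet_Ici),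
    lintegral_withDensity_eq_lintegral_mul _ hpdf hh',
    ← lintegral_const_mul _ (hpdf.mul hh'),
    ← lintegral_add_right_eq_self _ c]
  refine lintegral_congr fun x => ?_
  simp only [Pi.mul_apply]
  rw [← mul_assoc]
  rcases lt_or_ge x 0 with hx | hx
  · rw [indicator_of_notMem (by simpa using hx), exponentialPDF_of_neg hx]; simp
  · rw [indicator_of_mem (by simpa using hx), exponentialPDF_of_nonneg hx,
      exponentialPDF_of_nonneg (by linarith), ← ENNReal.ofReal_mul (Real.exp_nonneg _)]
    congr 2
    rw [show -(lam * (x + c)) = -(lam * c) + -(lam * x) by ring, Real.exp_add]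
    ring

/-- The truncated length is an exponential time stopped at `r`. -/
theorem lengthLaw_eq_map (hlam : 0 < lam) {r : ℝ} (hr : 0 ≤ r) :
    lengthLaw lam r = (expMeasure lam).map fun l => min l r := by
  have := isProbabilityMeasure_expMeasure hlam
  have hm : Measurable fun l : ℝ => min l r := measurable_id.min measurable_const
  rw [← Measure.restrict_add_restrict_compl (μ := expMeasure lam) (measurableSet_Iic (a := r)),
    Measure.map_add _ _ hm, lengthLaw, add_comm]
  congr 1
  · rw [ProbabilityTheory.cond, ← expMeasure_Iic hlam hr, smul_smul]
    have h1 : ((expMeasure lam).restrict (Iic r)).map (fun l => min l r) =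
        (expMeasure lam).restrict (Iic r) := by
      conv_rhs => rw [← Measure.map_id (μ := (expMeasure lam).restrict (Iic r))]
      refine Measure.map_congr ?_
      filter_upwards [ae_restrict_mem measurableSet_Iic] with l hl
      exact min_eq_left hl
    rw [h1]
    -- For `r = 0` the conditional law is the zero measure, with coefficient `0`.
    by_cases h0 : expMeasure lam (Iic r) = 0
    · rw [Measure.restrict_eq_zero.2 h0, smul_zero]
    · rw [ENNReal.mul_inv_cancel h0 (measure_ne_top _ _), one_smul]
  · have h1 : ((expMeasure lam).restrict (Iic r)ᶜ).map (fun l => min l r) =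
        ((expMeasure lam).restrict (Iic r)ᶜ).map fun _ => r := by
      refine Measure.map_congr ?_
      filter_upwards [ae_restrict_mem measurableSet_Iic.compl] with l hl
      exact min_eq_right (not_le.1 fun h => hl h).le
    rw [h1, Measure.map_const, Measure.restrict_apply_univ, compl_Iic, expMeasure_Ioi hlam hr]

theorem lintegral_startLaw {L : ℝ} (hlam : 0 < lam) (hL : 0 < L) (f : ℝ → ℝ≥0∞) :
    ENNReal.ofReal (1 + lam * L) * ∫⁻ s, f s ∂startLaw lam L =
      f 0 + ENNReal.ofReal lam * ∫⁻ s in Ioc 0 L, f s := by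
  have hc : 0 < 1 + lam * L := by positivity
  have hLe : ENNReal.ofReal L ≠ 0 := by simpa using hL
  rw [startLaw, lintegral_add_measure, lintegral_smul_measure, lintegral_smul_measure,
    lintegral_dirac, ProbabilityTheory.cond, lintegral_smul_measure, Real.volume_Ioc, sub_zero,
    smul_eq_mul, smul_eq_mul, smul_eq_mul, mul_add, ← mul_assoc, ← mul_assoc, ← mul_assoc,
    ← ENNReal.ofReal_mul hc.le, ← ENNReal.ofReal_mul hc.le, mul_one_div_cancel hc.ne',
    mul_div_cancel₀ _ hc.ne', ENNReal.ofReal_one, one_mul, ENNReal.ofReal_mul hlam.le,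
    mul_assoc _ _ _⁻¹,
    ENNReal.mul_inv_cancel hLe ENNReal.ofReal_ne_top, mul_one]

theorem ae_startLaw_mem {L : ℝ} (hL : 0 < L) : ∀ᵐ s ∂startLaw lam L, s ∈ Icc 0 L := by
  rw [startLaw, ae_add_measure_iff]
  constructor
  · refine Measure.ae_smul_measure ?_ _
    rw [ae_dirac_eq]
    exact ⟨le_rfl, hL.le⟩
  · refine Measure.ae_smul_measure (Measure.ae_smul_measure ?_ _) _
    filter_upwards [ae_restrict_mem measurableSet_Ioc] with s hs
    exact Ioc_subset_Icc_self hs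

theorem sideLaw_eq_bind (hlam : 0 < lam) {a b : ℝ} (hab : a < b) :
    sideLaw lam a b = (startLaw lam (b - a)).bind fun s =>
      (expMeasure lam).map fun l => (a + s, min (a + s + l) b) := by
  rw [sideLaw]
  refine Measure.bind_congr_right ?_
  filter_upwards [ae_startLaw_mem (sub_pos.2 hab)] with s hs
  rw [lengthLaw_eq_map hlam (by linarith [hs.2]), Measure.map_map (by fun_prop) (by fun_prop)]
  congr 1
  ext1 l
  simp only [Function.comp_apply, ← min_add_add_left]
  congr 2
  ring

/-- The integral of `f` over the terminal position, for the initial position `u` and the right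
end `b`. -/
noncomputable def sideInt (lam : ℝ) (f : ℝ × ℝ → ℝ≥0∞) (b u : ℝ) : ℝ≥0∞ :=
  ∫⁻ l, f (u, min (u + l) b) ∂expMeasure lam

/-- Up to normalization, the initial position has an atom of mass `1` at the left end and density
`lam`, and the length is exponential, stopped at the right end. -/
theorem lintegral_sideLaw (hlam : 0 < lam) {a b : ℝ} (hab : a < b) {f : ℝ × ℝ → ℝ≥0∞}
    (hf : Measurable f) :
    ENNReal.ofReal (1 + lam * (b - a)) * ∫⁻ p, f p ∂sideLaw lam a b =
      sideInt lam f b a + ENNReal.ofReal lam * ∫⁻ u in Ioc a b, sideInt lam f b u := by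
  have := isProbabilityMeasure_expMeasure hlam
  have hk : Measurable fun s : ℝ =>
      (expMeasure lam).map fun l => (a + s, min (a + s + l) b) := by
    have hg : Measurable fun p : ℝ × ℝ => (a + p.1, min (a + p.1 + p.2) b) := by fun_prop
    have := (Measure.measurable_map _ hg).comp
      (Measurable.map_prodMk_left (ν := expMeasure lam) (α := ℝ))
    convert this using 2 with s
    rw [Function.comp_apply, Measure.map_map hg measurable_prodMk_left]
    rfl
  rw [sideLaw_eq_bind hlam hab, Measure.lintegral_bind hk.aemeasurable hf.aemeasurable]
  have hint : ∀ s, ∫⁻ p, f p ∂(expMeasure lam).map (fun l => (a + s, min (a + s + l) b)) =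
      sideInt lam f b (s + a) := fun s => by
    rw [lintegral_map hf (by fun_prop), sideInt, add_comm a s]
  simp only [hint]
  rw [lintegral_startLaw hlam (sub_pos.2 hab) (fun s => sideInt lam f b (s + a)), zero_add]
  congr 2
  rw [← lintegral_indicator measurableSet_Ioc, ← lintegral_indicator measurableSet_Ioc,
    ← lintegral_add_right_eq_self ((Ioc a b).indicator _) a]
  refine lintegral_congr fun s => ?_
  simp only [indicator, mem_Ioc, lt_add_iff_pos_left, le_sub_iff_add_le]

theorem isProbabilityMeasure_sideLaw (hlam : 0 < lam) {a b : ℝ} (hab : a < b) :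
    IsProbabilityMeasure (sideLaw lam a b) := by
  have := isProbabilityMeasure_expMeasure hlam
  have hba := sub_pos.2 hab
  have h := lintegral_sideLaw hlam hab (f := fun _ => 1) measurable_const
  simp only [sideInt, lintegral_const, measure_univ, one_mul, Measure.restrict_apply_univ,
    Real.volume_Ioc] at h
  rw [← ENNReal.ofReal_mul hlam.le, ← ENNReal.ofReal_one,
    ← ENNReal.ofReal_add zero_le_one (by positivity)] at h
  have hc : 0 < 1 + lam * (b - a) := by positivity
  refine ⟨(ENNReal.mul_right_inj (a := ENNReal.ofReal (1 + lam * (b - a))) (by simpa using hc)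
    ENNReal.ofReal_ne_top).1 ?_⟩
  simpa using h

theorem ae_sideLaw (hlam : 0 < lam) {a b : ℝ} (hab : a < b) :
    ∀ᵐ p ∂sideLaw lam a b, a ≤ p.1 ∧ p.1 ≤ p.2 ∧ p.2 ≤ b := by
  have := isProbabilityMeasure_expMeasure hlam
  have hba := sub_pos.2 hab
  have hc : 0 < 1 + lam * (b - a) := by positivity
  have hs : MeasurableSet {p : ℝ × ℝ | a ≤ p.1 ∧ p.1 ≤ p.2 ∧ p.2 ≤ b} := by
    measurability
  have h := lintegral_sideLaw hlam hab (measurable_one.indicator hs.compl)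
  have h0 : ∀ u ∈ Icc a b, sideInt lam
      (indicator {p : ℝ × ℝ | a ≤ p.1 ∧ p.1 ≤ p.2 ∧ p.2 ≤ b}ᶜ 1) b u = 0 := by
    intro u hu
    rw [sideInt, lintegral_eq_zero_iff' (by
      have : Measurable (indicator {p : ℝ × ℝ | a ≤ p.1 ∧ p.1 ≤ p.2 ∧ p.2 ≤ b}ᶜ
          (1 : ℝ × ℝ → ℝ≥0∞)) := measurable_one.indicator hs.compl
      fun_prop)]
    filter_upwards [ae_expMeasure_pos hlam] with l hl
    refine indicator_of_notMem ?_ _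
    simp only [mem_compl_iff, mem_ofPred_eq, not_not]
    exact ⟨hu.1, le_min (by linarith) hu.2, min_le_right _ _⟩
  rw [h0 a ⟨le_rfl, hab.le⟩, setLIntegral_congr_fun measurableSet_Ioc
    (fun u hu => h0 u (Ioc_subset_Icc_self hu)), lintegral_zero, mul_zero, add_zero,
    lintegral_indicator_one hs.compl] at h
  exact (mul_eq_zero.1 h).resolve_left (by simpa using hc)

theorem setLIntegral_Ioc_exp (hlam : 0 < lam) {a a' : ℝ} (h : a ≤ a') :
    ENNReal.ofReal lam * ∫⁻ u in Ioc a a', ENNReal.ofReal (Real.exp (-(lam * (a' - u)))) =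
      ENNReal.ofReal (1 - Real.exp (-(lam * (a' - a)))) := by
  have hcont : Continuous fun u => lam * Real.exp (-(lam * (a' - u))) := by fun_prop
  have hi : IntegrableOn (fun u => lam * Real.exp (-(lam * (a' - u)))) (Ioc a a') :=
    hcont.integrableOn_Ioc
  rw [← lintegral_const_mul _ (by fun_prop)]
  simp only [← ENNReal.ofReal_mul hlam.le]
  rw [← ofReal_integral_eq_lintegral_ofReal hi (ae_of_all _ fun u => by positivity),
    ← intervalIntegral.integral_of_le h]
  rw [intervalIntegral.integral_eq_sub_of_hasDerivAt (f := fun u => Real.exp (-(lam * (a' - u))))]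
  · simp
  · intro u _
    have h1 : HasDerivAt (fun u => -(lam * (a' - u))) lam u := by
      have := ((hasDerivAt_id u).const_sub a').const_mul (-lam)
      simpa using this
    simpa [mul_comm] using h1.exp
  · exact hcont.intervalIntegrable _ _

/-- The side of a box in `[a, b]` that meets `[a', b']`, intersected with `[a', b']`, is
distributed as a side of a box in `[a', b']`. The mass `1` of the initial position `a'` combines the
sides that start at `a` and those that start in `(a, a']`, all being of exponential length
after `a'`. -/
theorem map_clip_sideLaw (hlam : 0 < lam) {a b a' b' : ℝ} (ha : a ≤ a') (hab : a' < b')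
    (hb : b' ≤ b) :
    ((sideLaw lam a b).restrict {p | max p.1 a' ≤ min p.2 b'}).map
        (fun p => (max p.1 a', min p.2 b')) =
      Real.toNNReal ((1 + lam * (b' - a')) / (1 + lam * (b - a))) • sideLaw lam a' b' := by
  have := isProbabilityMeasure_expMeasure hlam
  have hba := sub_pos.2 hab
  have hba' : 0 < b - a := by linarith
  have hc : 0 < 1 + lam * (b - a) := by positivity
  have hs : MeasurableSet {p : ℝ × ℝ | max p.1 a' ≤ min p.2 b'} :=
    measurableSet_le (by fun_prop) (by fun_prop)
  refine Measure.ext_of_lintegral _ fun f hf => ?_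
  set F : ℝ × ℝ → ℝ≥0∞ := indicator {p | max p.1 a' ≤ min p.2 b'}
    fun p => f (max p.1 a', min p.2 b') with hF
  have hFm : Measurable F := (show Measurable fun p : ℝ × ℝ => f (max p.1 a', min p.2 b') by
    fun_prop).indicator hs
  rw [lintegral_map hf (by fun_prop), ← lintegral_indicator hs, lintegral_smul_measure,
    ENNReal.smul_def, smul_eq_mul]
  refine (ENNReal.mul_right_inj (a := ENNReal.ofReal (1 + lam * (b - a))) (by simpa using hc)
    ENNReal.ofReal_ne_top).1 ?_
  rw [← hF, lintegral_sideLaw hlam (by linarith) hFm, ← mul_assoc]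
  change _ = ENNReal.ofReal _ * ENNReal.ofReal _ * _
  rw [← ENNReal.ofReal_mul hc.le, mul_div_cancel₀ _ hc.ne', lintegral_sideLaw hlam hab hf]
  -- A side starting at `u ≤ a'` reaches `a'` with probability `exp (-lam (a' - u))`, and then its
  -- remaining length is again exponential.
  have hleft : ∀ u ≤ a', sideInt lam F b u =
      ENNReal.ofReal (Real.exp (-(lam * (a' - u)))) * sideInt lam f b' a' := fun u hu => by
    have h1 : sideInt lam F b u =
        ∫⁻ l in Ici (a' - u), f (a', min (u + l) b') ∂expMeasure lam := by
      rw [sideInt, ← lintegral_indicator measurableSet_Ici]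
      refine lintegral_congr fun l => ?_
      have e1 : min (min (u + l) b) b' = min (u + l) b' := by
        rw [min_assoc, min_eq_right hb]
      simp only [hF, indicator, mem_ofPred_eq, max_eq_right hu, e1, mem_Ici, le_min_iff, hab.le,
        hab.le.trans hb, and_true, sub_le_iff_le_add']
    rw [h1, setLIntegral_Ici_expMeasure (by linarith) (by fun_prop), sideInt]
    congr 1
    refine lintegral_congr fun l => ?_
    rw [show u + (l + (a' - u)) = a' + l by ring]
  have hmid : ∀ u ∈ Ioc a' b', sideInt lam F b u = sideInt lam f b' u := fun u hu => by
    rw [sideInt, sideInt]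
    refine lintegral_congr_ae ?_
    filter_upwards [ae_expMeasure_pos hlam] with l hl
    have e1 : min (min (u + l) b) b' = min (u + l) b' := by
      rw [min_assoc, min_eq_right hb]
    have e2 : u ≤ min (u + l) b' := le_min (by linarith) hu.2
    simp only [hF, indicator, mem_ofPred_eq, max_eq_left hu.1.le, e1, if_pos e2]
  -- A side starting to the right of `b'` does not meet `[a', b']`.
  have hright : ∀ u ∈ Ioc b' b, sideInt lam F b u = 0 := fun u hu => by
    rw [sideInt]
    refine (lintegral_congr fun l => ?_).trans lintegral_zero
    refine indicator_of_notMem ?_ _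
    simp only [mem_ofPred_eq, not_le]
    exact (min_le_right _ _).trans_lt (hu.1.trans_le (le_max_left _ _))
  have hd1 : Disjoint (Ioc a a') (Ioc a' b) := by
    rw [Ioc_disjoint_Ioc]; simp
  have hd2 : Disjoint (Ioc a' b') (Ioc b' b) := by
    rw [Ioc_disjoint_Ioc]; simp
  rw [← Ioc_union_Ioc_eq_Ioc ha (hab.le.trans hb), lintegral_union measurableSet_Ioc hd1,
    ← Ioc_union_Ioc_eq_Ioc hab.le hb, lintegral_union measurableSet_Ioc hd2,
    setLIntegral_congr_fun measurableSet_Ioc (fun u hu => hleft u hu.2),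
    setLIntegral_congr_fun measurableSet_Ioc hmid,
    setLIntegral_congr_fun measurableSet_Ioc hright, lintegral_zero, add_zero, hleft a ha,
    lintegral_mul_const _ (by fun_prop), mul_add, ← mul_assoc, setLIntegral_Ioc_exp hlam ha,
    ← add_assoc, ← add_mul, ← ENNReal.ofReal_add (Real.exp_nonneg _) (by
      rw [sub_nonneg, Real.exp_le_one_iff]; nlinarith [mul_nonneg hlam.le (sub_nonneg.2 ha)]),
    add_sub_cancel, ENNReal.ofReal_one, one_mul]

end Side

/-! ### The law of one bounding box -/

section BoxLaw

open scoped NNReal ENNReal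
open Set

theorem pi_smul_measure {ι : Type*} [Fintype ι] {α : ι → Type*} [∀ i, MeasurableSpace (α i)]
    (c : ι → ℝ≥0) (μ : ∀ i, Measure (α i)) [∀ i, SigmaFinite (μ i)] :
    Measure.pi (fun i => c i • μ i) = (∏ i, c i) • Measure.pi μ := by
  refine Measure.pi_eq fun s _ => ?_
  simp only [Measure.smul_apply, Measure.pi_pi, ENNReal.smul_def, smul_eq_mul,
    Finset.prod_mul_distrib, ENNReal.ofNNReal_finsetProd]

variable {D : ℕ} {lam : ℝ}

/-- The probability that a bounding box in `Y` meets the smaller domain `X`. -/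
noncomputable def meetProb (lam : ℝ) (X Y : BoxIntegral.Box (Fin D)) : ℝ≥0 :=
  ∏ d, Real.toNNReal ((1 + lam * (X.upper d - X.lower d)) / (1 + lam * (Y.upper d - Y.lower d)))

theorem isProbabilityMeasure_boxLaw (hlam : 0 < lam) (X : BoxIntegral.Box (Fin D)) :
    IsProbabilityMeasure (boxLaw lam X) := by
  have := fun d => isProbabilityMeasure_sideLaw hlam (X.lower_lt_upper d)
  unfold boxLaw
  infer_instance

theorem ae_boxLaw (hlam : 0 < lam) (X : BoxIntegral.Box (Fin D)) :
    ∀ᵐ B ∂boxLaw lam X, ∀ d, X.lower d ≤ (B d).1 ∧ (B d).1 ≤ (B d).2 ∧ (B d).2 ≤ X.upper d := by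
  have := fun d => isProbabilityMeasure_sideLaw hlam (X.lower_lt_upper d)
  rw [ae_all_iff]
  intro d
  exact (Measure.tendsto_eval_ae_ae (μ := fun d => sideLaw lam (X.lower d) (X.upper d))
    (i := d)).eventually (ae_sideLaw hlam (X.lower_lt_upper d))

theorem measurableSet_meets (X : BoxIntegral.Box (Fin D)) : MeasurableSet {B | Meets X B} := by
  have : {B : BoundingBox D | Meets X B} =
      ⋂ d, {B | max (B d).1 (X.lower d) ≤ min (B d).2 (X.upper d)} := by
    ext B; simp [Meets, clip]
  rw [this]
  exact MeasurableSet.iInter fun d => measurableSet_le (by fun_prop) (by fun_prop)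

theorem measurable_clip (X : BoxIntegral.Box (Fin D)) : Measurable (clip X) := by
  unfold clip
  fun_prop

/-- The bounding boxes in `Y` that meet `X`, intersected with `X`, are distributed as bounding boxes
in `X`. -/
theorem map_clip_boxLaw (hlam : 0 < lam) {X Y : BoxIntegral.Box (Fin D)} (h : X ≤ Y) :
    ((boxLaw lam Y).restrict {B | Meets X B}).map (clip X) = meetProb lam X Y • boxLaw lam X := by
  have hY := fun d => isProbabilityMeasure_sideLaw hlam (Y.lower_lt_upper d)
  have hX := fun d => isProbabilityMeasure_sideLaw hlam (X.lower_lt_upper d)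
  have hs : {B : BoundingBox D | Meets X B} =
      univ.pi fun d => {p : ℝ × ℝ | max p.1 (X.lower d) ≤ min p.2 (X.upper d)} := by
    ext B; simp [Meets, clip]
  have hle := BoxIntegral.Box.le_iff_bounds.1 h
  rw [hs, boxLaw, Measure.restrict_pi_pi]
  have hm := fun d => map_clip_sideLaw hlam (hle.1 d) (X.lower_lt_upper d) (hle.2 d)
  have hsf : ∀ d, SigmaFinite (((sideLaw lam (Y.lower d) (Y.upper d)).restrict
      {p : ℝ × ℝ | max p.1 (X.lower d) ≤ min p.2 (X.upper d)}).map
        fun p : ℝ × ℝ => (max p.1 (X.lower d), min p.2 (X.upper d))) := fun d => by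
    rw [hm d]; infer_instance
  have key := Measure.pi_map_pi (hμ := hsf) (fun d => by fun_prop)
  simp only [hm] at key
  rw [pi_smul_measure] at key
  exact key

theorem boxLaw_meets (hlam : 0 < lam) {X Y : BoxIntegral.Box (Fin D)} (h : X ≤ Y) :
    boxLaw lam Y {B | Meets X B} = meetProb lam X Y := by
  have := isProbabilityMeasure_boxLaw hlam X
  have h1 := congrArg (fun μ => μ univ) (map_clip_boxLaw hlam h)
  rwa [Measure.map_apply (measurable_clip X) MeasurableSet.univ, preimage_univ,
    Measure.restrict_apply_univ, Measure.smul_apply, measure_univ, ENNReal.smul_def, smul_eq_mul,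
    mul_one] at h1

theorem meetProb_le_one (hlam : 0 < lam) {X Y : BoxIntegral.Box (Fin D)} (h : X ≤ Y) :
    meetProb lam X Y ≤ 1 := by
  have := isProbabilityMeasure_boxLaw hlam Y
  have h1 := prob_le_one (μ := boxLaw lam Y) (s := {B | Meets X B})
  rw [boxLaw_meets hlam h] at h1
  exact_mod_cast h1

/-- The mean number of bounding boxes. -/
noncomputable def meanCount (τ lam : ℝ) (X : BoxIntegral.Box (Fin D)) : ℝ≥0 :=
  Real.toNNReal (τ * ∏ d, (1 + lam * (X.upper d - X.lower d)))

theorem meanCount_mul_meetProb {τ : ℝ} (hτ : 0 < τ) (hlam : 0 < lam)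
    (X Y : BoxIntegral.Box (Fin D)) :
    meanCount τ lam Y * meetProb lam X Y = meanCount τ lam X := by
  have hpos : ∀ (Z : BoxIntegral.Box (Fin D)) d, 0 < 1 + lam * (Z.upper d - Z.lower d) :=
    fun Z d => by have := sub_pos.2 (Z.lower_lt_upper d); positivity
  rw [meanCount, meetProb, meanCount,
    ← Real.toNNReal_prod_of_nonneg fun d _ => (div_pos (hpos X d) (hpos Y d)).le,
    ← Real.toNNReal_mul (mul_nonneg hτ.le (Finset.prod_nonneg fun d _ => (hpos Y d).le)),
    Finset.prod_div_distrib, mul_assoc,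
    mul_div_cancel₀ _ (Finset.prod_ne_zero_iff.2 fun d _ => (hpos Y d).ne')]

end BoxLaw

/-! ### Sorting by arrival times, and costs -/

section Sorting

variable {α β : Type*}

/-- Order points, given with their arrival times, by these times. -/
noncomputable def byTime (l : List (α × ℝ)) : List (α × ℝ) :=
  l.insertionSort fun p q => p.2 ≤ q.2

/-- Replace the increasing arrival times after `t₀` by the costs, their successive differences. -/
def costs : ℝ → List (α × ℝ) → List (α × ℝ)
  | _, [] => []
  | t₀, p :: l => (p.1, p.2 - t₀) :: costs p.2 l

theorem pairwise_byTime (l : List (α × ℝ)) : (byTime l).Pairwise fun p q => p.2 ≤ q.2 :=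
  have : IsTrans (α × ℝ) fun p q => p.2 ≤ q.2 := ⟨fun _ _ _ h h' => h.trans h'⟩
  have : Std.Total (α := α × ℝ) fun p q => p.2 ≤ q.2 := ⟨fun p q => le_total p.2 q.2⟩
  List.pairwise_insertionSort _ l

open Classical in
theorem thin_orderedInsert (s : Set (α × ℝ)) {φ : α × ℝ → β × ℝ} (hφ : ∀ p, (φ p).2 = p.2)
    (p : α × ℝ) {l : List (α × ℝ)} (hl : l.Pairwise fun p q => p.2 ≤ q.2) :
    thin s φ (l.orderedInsert (fun p q => p.2 ≤ q.2) p) =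
      if p ∈ s then (thin s φ l).orderedInsert (fun p q => p.2 ≤ q.2) (φ p) else thin s φ l := by
  induction l with
  | nil => by_cases h : p ∈ s <;> simp [h, thin_cons_of_mem, thin_cons_of_notMem, thin_nil]
  | cons q l ih =>
    rw [List.pairwise_cons] at hl
    by_cases hpq : p.2 ≤ q.2
    · rw [List.orderedInsert_cons, if_pos hpq]
      by_cases hp : p ∈ s
      · rw [thin_cons_of_mem hp, if_pos hp]
        have hle : ∀ y ∈ thin s φ (q :: l), (φ p).2 ≤ y.2 := by
          intro y hy
          simp only [thin, List.mem_filterMap, Option.ite_none_right_eq_some,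
            Option.some.injEq] at hy
          obtain ⟨x, hx, -, rfl⟩ := hy
          rw [hφ, hφ]
          rcases List.mem_cons.1 hx with rfl | hx
          · exact hpq
          · exact hpq.trans (hl.1 x hx)
        cases hL : thin s φ (q :: l) with
        | nil => rfl
        | cons y L =>
          rw [List.orderedInsert_cons, if_pos (hle y (by simp [hL]))]
      · rw [thin_cons_of_notMem hp, if_neg hp]
    · rw [List.orderedInsert_cons, if_neg hpq]
      by_cases hq : q ∈ s
      · rw [thin_cons_of_mem hq, thin_cons_of_mem hq, ih hl.2]
        have hφpq : ¬ (φ p).2 ≤ (φ q).2 := by rwa [hφ, hφ]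
        split_ifs
        · rw [List.orderedInsert_cons, if_neg hφpq]
        · rfl
      · rw [thin_cons_of_notMem hq, thin_cons_of_notMem hq, ih hl.2]

/-- Sorting by time commutes with thinning. -/
theorem thin_byTime (s : Set (α × ℝ)) {φ : α × ℝ → β × ℝ} (hφ : ∀ p, (φ p).2 = p.2)
    (l : List (α × ℝ)) : thin s φ (byTime l) = byTime (thin s φ l) := by
  induction l with
  | nil => rfl
  | cons p l ih =>
    have : byTime (p :: l) = (byTime l).orderedInsert (fun p q => p.2 ≤ q.2) p := rfl
    rw [this, thin_orderedInsert s hφ p (pairwise_byTime l)]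
    split_ifs with hp
    · rw [thin_cons_of_mem hp, ih]; rfl
    · rw [thin_cons_of_notMem hp, ih]

theorem ofFn_cost_eq_costs {n : ℕ} (B : Fin n → α) (t : Fin n → ℝ) (t₀ : ℝ) :
    (List.ofFn fun k => (B k, t k - (Fin.cons t₀ t : Fin (n + 1) → ℝ) k.castSucc)) =
      costs t₀ (List.ofFn fun k => (B k, t k)) := by
  induction n generalizing t₀ with
  | zero => simp [costs]
  | succ n ih =>
    rw [List.ofFn_succ, List.ofFn_succ, costs, ← ih (fun k => B k.succ) (fun k => t k.succ)]
    have h : (Fin.cons (t 0) fun k => t k.succ : Fin (n + 1) → ℝ) = t := Fin.cons_self_tail t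
    simp [h]

/-- `byTime` and `Tuple.sort` sort alike when equal times carry equal marks. -/
theorem byTime_ofFn {n : ℕ} {B : Fin n → α} {t : Fin n → ℝ}
    (ht : ∀ i j, t i = t j → B i = B j) :
    byTime (List.ofFn fun k => (B k, t k)) =
      List.ofFn fun k => (B (Tuple.sort t k), t (Tuple.sort t k)) := by
  refine List.Perm.eq_of_pairwise (le := fun p q => p.2 ≤ q.2) ?_ (pairwise_byTime _) ?_ ?_
  · intro p q hp hq h1 h2
    rw [byTime, List.mem_insertionSort, List.mem_ofFn] at hp
    rw [List.mem_ofFn] at hq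
    obtain ⟨i, rfl⟩ := hp
    obtain ⟨j, rfl⟩ := hq
    have hij : t i = t (Tuple.sort t j) := le_antisymm h1 h2
    exact Prod.ext (ht _ _ hij) hij
  · rw [List.pairwise_ofFn]
    intro i j hij
    exact Tuple.monotone_sort t hij.le
  · refine (List.perm_insertionSort _ _).trans ?_
    exact ((Tuple.sort t).ofFn_comp_perm fun k => (B k, t k)).symm

variable [MeasurableSpace α]

theorem measurable_byTime : Measurable (byTime : List (α × ℝ) → List (α × ℝ)) := by
  have hins : Measurable fun p : (α × ℝ) × List (α × ℝ) =>
      p.2.orderedInsert (fun p q => p.2 ≤ q.2) p.1 := by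
    refine measurable_prod_list_rec (f := fun p (l : List (α × ℝ)) =>
      l.orderedInsert (fun p q => p.2 ≤ q.2) p) ?_ fun n ih => ?_
    · simp only [List.orderedInsert_nil]
      exact measurable_cons.comp (measurable_id.prodMk measurable_const)
    · simp only [List.orderedInsert_cons]
      have hl : Measurable fun p : (α × ℝ) × (α × ℝ) × (Fin n → α × ℝ) => List.ofFn p.2.2 :=
        (measurable_ofFn n).comp (by fun_prop)
      refine Measurable.ite (measurableSet_le (by fun_prop) (by fun_prop)) ?_ ?_
      · exact measurable_cons.comp (measurable_fst.prodMk
          (measurable_cons.comp (Measurable.prodMk (by fun_prop) hl)))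
      · exact measurable_cons.comp (Measurable.prodMk (by fun_prop)
          (ih.comp (f := fun p : (α × ℝ) × (α × ℝ) × (Fin n → α × ℝ) => (p.1, p.2.2))
            (by fun_prop)))
  refine measurable_list_rec fun n ih => ?_
  exact hins.comp (measurable_fst.prodMk (ih.comp measurable_snd))

theorem measurable_costs (t₀ : ℝ) : Measurable (costs t₀ : List (α × ℝ) → List (α × ℝ)) := by
  have : Measurable fun p : ℝ × List (α × ℝ) => costs p.1 p.2 := by
    refine measurable_prod_list_rec (f := fun t₀ (l : List (α × ℝ)) => costs t₀ l) ?_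
      fun n ih => ?_
    · simp only [costs]
      exact measurable_const
    · simp only [costs]
      exact measurable_cons.comp (Measurable.prodMk (by fun_prop)
        (ih.comp (f := fun p : ℝ × (α × ℝ) × (Fin n → α × ℝ) => (p.2.1.2, p.2.2)) (by fun_prop)))
  exact this.comp measurable_prodMk_left

end Sorting

/-! ### Restriction as thinning -/

section Restriction

variable {D : ℕ}

/-- Restrict the bounding box and keep the time. -/
def clipMark (X : BoxIntegral.Box (Fin D)) (p : MarkedBox D) : MarkedBox D := (clip X p.1, p.2)

/-- In terms of arrival times, the restriction to `X` is a thinning. -/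
theorem restrictList_costs (X : BoxIntegral.Box (Fin D)) (c t₀ : ℝ) (l : List (MarkedBox D)) :
    restrictList X c (costs t₀ l) = costs (t₀ - c) (thin {p | Meets X p.1} (clipMark X) l) := by
  induction l generalizing c t₀ with
  | nil => rfl
  | cons p l ih =>
    by_cases h : Meets X p.1
    · rw [costs, restrictList, if_pos h, thin_cons_of_mem (show p ∈ {p | Meets X p.1} from h),
        costs, ih, sub_zero]
      simp only [clipMark]
      congr 2
      ring
    · rw [costs, restrictList, if_neg h,
        thin_cons_of_notMem (show p ∉ {p | Meets X p.1} from h), ih]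
      congr 1
      ring

theorem measurable_restrictList (X : BoxIntegral.Box (Fin D)) (c : ℝ) :
    Measurable (restrictList X c) := by
  classical
  have : Measurable fun p : ℝ × List (MarkedBox D) => restrictList X p.1 p.2 := by
    refine measurable_prod_list_rec (f := fun c l => restrictList X c l) ?_ fun n ih => ?_
    · simp only [restrictList]
      exact measurable_const
    · simp only [restrictList]
      refine Measurable.ite (measurableSet_meets X |>.preimage (by fun_prop)) ?_ ?_
      · refine measurable_cons.comp (Measurable.prodMk (Measurable.prodMk
          ((measurable_clip X).comp (by fun_prop)) (by fun_prop)) ?_)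
        exact ih.comp (f := fun p : ℝ × MarkedBox D × (Fin n → MarkedBox D) => (0, p.2.2))
          (by fun_prop)
      · exact ih.comp (f := fun p : ℝ × MarkedBox D × (Fin n → MarkedBox D) =>
          (p.1 + p.2.1.2, p.2.2)) (by fun_prop)
  exact this.comp measurable_prodMk_left

theorem isIn_of_mem_costs (X : BoxIntegral.Box (Fin D)) {l : List (MarkedBox D)} {t₀ : ℝ}
    (hl : l.Pairwise fun p q => p.2 < q.2) (h0 : ∀ p ∈ l, t₀ < p.2)
    (hB : ∀ p ∈ l, ∀ d, X.lower d ≤ (p.1 d).1 ∧ (p.1 d).1 ≤ (p.1 d).2 ∧ (p.1 d).2 ≤ X.upper d) :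
    ∀ p ∈ costs t₀ l, IsIn X p := by
  induction l generalizing t₀ with
  | nil => simp [costs]
  | cons q l ih =>
    rw [List.pairwise_cons] at hl
    rw [costs, List.forall_mem_cons]
    refine ⟨⟨hB q (by simp), ?_⟩, ih hl.2 hl.1 fun p hp => hB p (by simp [hp])⟩
    have := h0 q (by simp)
    simp only
    linarith

end Restriction

/-! ### The generated sequence as a Poisson process in boxes and times -/

section SeqLaw

open scoped NNReal ENNReal
open Set

/-- The uniform law on `(0, τ]`. -/
noncomputable abbrev uniformTime (τ : ℝ) : Measure ℝ := ProbabilityTheory.cond volume (Ioc 0 τ)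

theorem isProbabilityMeasure_uniformTime {τ : ℝ} (hτ : 0 < τ) :
    IsProbabilityMeasure (uniformTime τ) :=
  cond_isProbabilityMeasure_of_finite (by simpa using hτ) (by simp)

theorem ae_uniformTime_pos (τ : ℝ) : ∀ᵐ t ∂uniformTime τ, 0 < t := by
  refine Measure.ae_smul_measure ?_ _
  filter_upwards [ae_restrict_mem measurableSet_Ioc] with t ht
  exact ht.1

/-- Ties between independent uniform times have probability zero. -/
theorem ae_injective_pi_uniformTime {τ : ℝ} (hτ : 0 < τ) (n : ℕ) :
    ∀ᵐ t ∂Measure.pi fun _ : Fin n => uniformTime τ, Function.Injective t := by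
  have hvol : ∀ᵐ t : Fin n → ℝ, Function.Injective t := by
    have : ∀ i j : Fin n, i ≠ j → ∀ᵐ t : Fin n → ℝ, t i ≠ t j := by
      intro i j hij
      let f : (Fin n → ℝ) →ₗ[ℝ] ℝ :=
        LinearMap.proj (R := ℝ) (φ := fun _ : Fin n => ℝ) i - LinearMap.proj j
      have hf : LinearMap.ker f ≠ ⊤ := by
        intro h
        have h1 : f (Pi.single i 1) = 0 := by
          rw [← LinearMap.mem_ker, h]; trivial
        simp [f, hij] at h1
      have h0 := Measure.addHaar_submodule (volume : Measure (Fin n → ℝ)) _ hf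
      rw [ae_iff]
      convert h0 using 2
      ext t
      simp [f, sub_eq_zero]
    have h2 : ∀ᵐ t : Fin n → ℝ, ∀ i j : Fin n, i ≠ j → t i ≠ t j := by
      simp only [ae_all_iff]
      exact this
    filter_upwards [h2] with t ht i j h
    by_contra hij
    exact ht i j hij h
  have hc : uniformTime τ = ((volume (Ioc 0 τ))⁻¹).toNNReal • volume.restrict (Ioc 0 τ) := by
    rw [uniformTime, ProbabilityTheory.cond]
    have : (volume (Ioc 0 τ))⁻¹ = (((volume (Ioc 0 τ))⁻¹).toNNReal : ℝ≥0∞) :=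
      (ENNReal.coe_toNNReal (by simpa using hτ)).symm
    conv_lhs => rw [this]
    rfl
  rw [hc, pi_smul_measure, ← Measure.restrict_pi_pi]
  exact Measure.ae_smul_measure (ae_restrict_of_ae hvol) _

theorem measurable_comp_sort (n : ℕ) :
    Measurable fun t : Fin n → ℝ => t ∘ Tuple.sort t := by
  -- The sorted tuple is read off from the sorted list of the times with trivial marks.
  refine measurable_pi_lambda _ fun k => ?_
  have h : (fun t : Fin n → ℝ => (t ∘ Tuple.sort t) k) = fun t =>
      ((byTime (List.ofFn fun k => ((), t k))).getD k ((), 0)).2 := by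
    ext t
    rw [byTime_ofFn fun _ _ _ => rfl]
    simp
  rw [h]
  exact measurable_snd.comp ((measurable_getD _ _).comp (measurable_byTime.comp
    ((measurable_ofFn n).comp (by fun_prop))))

/-- Permuting independent points with the same law does not change their law. -/
theorem lintegral_pi_comp_perm {α : Type*} [MeasurableSpace α] {n : ℕ} (μ : Measure α)
    [SigmaFinite μ] (σ : Equiv.Perm (Fin n)) {f : (Fin n → α) → ℝ≥0∞} (hf : Measurable f) :
    ∫⁻ B, f (B ∘ σ) ∂(Measure.pi fun _ : Fin n => μ) =
      ∫⁻ B, f B ∂(Measure.pi fun _ : Fin n => μ) := by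
  have h := (measurePreserving_piCongrLeft (fun _ : Fin n => μ) σ.symm).lintegral_comp hf
  rw [← h]
  refine lintegral_congr fun B => ?_
  congr 1
  ext1 i
  have := MeasurableEquiv.piCongrLeft_apply_apply σ.symm (β := fun _ : Fin n => α) B (σ i)
  rw [Equiv.symm_apply_apply] at this
  exact this.symm

theorem measurable_costs_zip (D n : ℕ) :
    Measurable fun p : (Fin n → BoundingBox D) × (Fin n → ℝ) =>
      costs 0 (List.ofFn fun k => (p.1 k, p.2 k)) :=
  (measurable_costs 0).comp ((measurable_ofFn n).comp (by fun_prop))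

theorem assemble_eq_costs {D n : ℕ} (B : Fin n → BoundingBox D) (t : Fin n → ℝ) :
    assemble B t = costs 0 (List.ofFn fun k => (B k, t k)) :=
  ofFn_cost_eq_costs B t 0

variable {D : ℕ} {τ lam : ℝ}

/-- Given the number of boxes, attaching the independent boxes to the sorted times amounts to
sorting independent pairs of a box and a time, because the boxes are exchangeable. -/
theorem map_assemble_eq_map_iidList (hτ : 0 < τ) (hlam : 0 < lam) (X : BoxIntegral.Box (Fin D))
    (n : ℕ) :
    ((Measure.pi fun _ : Fin n => boxLaw lam X).prod (timeLaw τ n)).map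
        (fun p => assemble p.1 p.2) =
      (iidList ((boxLaw lam X).prod (uniformTime τ)) n).map fun l => costs 0 (byTime l) := by
  have := isProbabilityMeasure_boxLaw hlam X
  have := isProbabilityMeasure_uniformTime hτ
  have hsm : Measurable fun l : List (MarkedBox D) => costs 0 (byTime l) :=
    (measurable_costs 0).comp measurable_byTime
  have hsort := measurable_comp_sort n
  simp only [assemble_eq_costs]
  refine Measure.ext_of_lintegral _ fun f hf => ?_
  have hg := hf.comp (measurable_costs_zip D n)
  set g : (Fin n → BoundingBox D) × (Fin n → ℝ) → ℝ≥0∞ := fun p =>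
    f (costs 0 (List.ofFn fun k => (p.1 k, p.2 k))) with hgdef
  have hg' : Measurable g := hg
  have hh : Measurable fun p : (Fin n → BoundingBox D) × (Fin n → ℝ) =>
      f (costs 0 (byTime (List.ofFn fun k => (p.1 k, p.2 k)))) :=
    hf.comp (hsm.comp ((measurable_ofFn n).comp (by fun_prop)))
  have hT : SFinite (timeLaw τ n) := by unfold timeLaw; infer_instance
  have e := measurePreserving_arrowProdEquivProdArrow (BoundingBox D) ℝ (Fin n)
    (fun _ => boxLaw lam X) (fun _ => uniformTime τ)
  calc ∫⁻ l, f l ∂((Measure.pi fun _ : Fin n => boxLaw lam X).prod (timeLaw τ n)).map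
        (fun p => costs 0 (List.ofFn fun k => (p.1 k, p.2 k)))
      = ∫⁻ p, g p ∂(Measure.pi fun _ : Fin n => boxLaw lam X).prod (timeLaw τ n) :=
        lintegral_map hf (measurable_costs_zip D n)
    _ = ∫⁻ t, ∫⁻ B, g (B, t) ∂(Measure.pi fun _ : Fin n => boxLaw lam X) ∂timeLaw τ n :=
        lintegral_prod_symm' _ hg'
    _ = ∫⁻ t, ∫⁻ B, g (B, t ∘ Tuple.sort t) ∂(Measure.pi fun _ : Fin n => boxLaw lam X)
          ∂(Measure.pi fun _ : Fin n => uniformTime τ) := by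
        rw [timeLaw, lintegral_map hg'.lintegral_prod_left' hsort]
    _ = ∫⁻ t, ∫⁻ B, f (costs 0 (byTime (List.ofFn fun k => (B k, t k))))
          ∂(Measure.pi fun _ : Fin n => boxLaw lam X)
          ∂(Measure.pi fun _ : Fin n => uniformTime τ) := by
        refine lintegral_congr_ae ?_
        filter_upwards [ae_injective_pi_uniformTime hτ n] with t ht
        rw [← lintegral_pi_comp_perm (f := fun B => g (B, t ∘ Tuple.sort t)) _ (Tuple.sort t)
          (hg'.comp measurable_prodMk_right)]
        refine lintegral_congr fun B => ?_
        rw [byTime_ofFn fun i j h => by rw [ht h]]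
        rfl
    _ = ∫⁻ p, f (costs 0 (byTime (List.ofFn fun k => (p.1 k, p.2 k))))
          ∂(Measure.pi fun _ : Fin n => boxLaw lam X).prod
            (Measure.pi fun _ : Fin n => uniformTime τ) := (lintegral_prod_symm' _ hh).symm
    _ = ∫⁻ l, f l ∂(iidList ((boxLaw lam X).prod (uniformTime τ)) n).map
          fun l => costs 0 (byTime l) := by
        rw [lintegral_map hf hsm, iidList, 
          lintegral_map (f := fun l => f (costs 0 (byTime l))) (hf.comp hsm) (measurable_ofFn n),
          ← e.lintegral_comp hh]
        rfl

/-- The generated sequence is obtained from a Poisson number of independent pairs of a box and a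
time by sorting. -/
theorem seqLaw_eq_map_poissonList (hτ : 0 < τ) (hlam : 0 < lam) (X : BoxIntegral.Box (Fin D)) :
    seqLaw τ lam X = (poissonList (meanCount τ lam X) ((boxLaw lam X).prod (uniformTime τ))).map
      fun l => costs 0 (byTime l) := by
  have hsm : Measurable fun l : List (MarkedBox D) => costs 0 (byTime l) :=
    (measurable_costs 0).comp measurable_byTime
  refine Measure.ext_of_lintegral _ fun f hf => ?_
  rw [seqLaw, Measure.lintegral_bind Measurable.of_discrete.aemeasurable hf.aemeasurable,
    lintegral_map hf hsm, poissonList,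
    Measure.lintegral_bind (f := fun l => f (costs 0 (byTime l)))
      Measurable.of_discrete.aemeasurable (hf.comp hsm).aemeasurable, meanCount]
  refine lintegral_congr fun n => ?_
  rw [map_assemble_eq_map_iidList hτ hlam, lintegral_map hf hsm]

theorem isProbabilityMeasure_seqLaw (hτ : 0 < τ) (hlam : 0 < lam) (X : BoxIntegral.Box (Fin D)) :
    IsProbabilityMeasure (seqLaw τ lam X) := by
  have := isProbabilityMeasure_boxLaw hlam X
  have := isProbabilityMeasure_uniformTime hτ
  rw [seqLaw_eq_map_poissonList hτ hlam]
  have : IsProbabilityMeasure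
      (poissonList (meanCount τ lam X) ((boxLaw lam X).prod (uniformTime τ))) := by
    refine ⟨?_⟩
    rw [poissonList, Measure.bind_apply .univ Measurable.of_discrete.aemeasurable]
    simp
  exact Measure.isProbabilityMeasure_map
    ((measurable_costs 0).comp measurable_byTime).aemeasurable

theorem measurableSet_isIn (X : BoxIntegral.Box (Fin D)) : MeasurableSet {p | IsIn X p} := by
  have : {p : MarkedBox D | IsIn X p} = (⋂ d, {p | X.lower d ≤ (p.1 d).1} ∩
      ({p | (p.1 d).1 ≤ (p.1 d).2} ∩ {p | (p.1 d).2 ≤ X.upper d})) ∩ {p | 0 < p.2} := by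
    ext p; simp [IsIn]
  rw [this]
  refine (MeasurableSet.iInter fun d => ?_).inter (measurableSet_lt (by fun_prop) (by fun_prop))
  exact (measurableSet_le (by fun_prop) (by fun_prop)).inter
    ((measurableSet_le (by fun_prop) (by fun_prop)).inter
      (measurableSet_le (by fun_prop) (by fun_prop)))

theorem ae_seqLaw_isIn (hτ : 0 < τ) (hlam : 0 < lam) (X : BoxIntegral.Box (Fin D)) :
    ∀ᵐ l ∂seqLaw τ lam X, ∀ p ∈ l, IsIn X p := by
  have := isProbabilityMeasure_boxLaw hlam X
  have := isProbabilityMeasure_uniformTime hτ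
  have hs := measurableSet_forall_mem (measurableSet_isIn X)
  rw [ae_iff, seqLaw]
  refine (Measure.bind_apply hs.compl Measurable.of_discrete.aemeasurable).trans ?_
  refine (lintegral_congr fun n => ?_).trans lintegral_zero
  have hT : SFinite (timeLaw τ n) := by unfold timeLaw; infer_instance
  have hB : ∀ᵐ B ∂(Measure.pi fun _ : Fin n => boxLaw lam X), ∀ k d,
      X.lower d ≤ (B k d).1 ∧ (B k d).1 ≤ (B k d).2 ∧ (B k d).2 ≤ X.upper d := by
    rw [ae_all_iff]
    intro k
    exact (Measure.tendsto_eval_ae_ae (μ := fun _ : Fin n => boxLaw lam X)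
      (i := k)).eventually (ae_boxLaw hlam X)
  have ht : ∀ᵐ t ∂timeLaw τ n, (∀ i j, i < j → t i < t j) ∧ ∀ i, 0 < t i := by
    have hm : MeasurableSet {t : Fin n → ℝ | (∀ i j, i < j → t i < t j) ∧ ∀ i, 0 < t i} := by
      measurability
    rw [timeLaw, ae_map_iff (measurable_comp_sort n).aemeasurable hm]
    have hpos : ∀ᵐ t ∂(Measure.pi fun _ : Fin n => uniformTime τ), ∀ k, 0 < t k := by
      rw [ae_all_iff]
      intro k
      exact (Measure.tendsto_eval_ae_ae (μ := fun _ : Fin n => uniformTime τ)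
        (i := k)).eventually (ae_uniformTime_pos τ)
    filter_upwards [hpos, ae_injective_pi_uniformTime hτ n] with t h1 h2
    refine ⟨fun i j hij => ?_, fun i => h1 _⟩
    exact ((Tuple.monotone_sort t).strictMono_of_injective
      (h2.comp (Tuple.sort t).injective)) hij
  have hassemble : Measurable fun p : (Fin n → BoundingBox D) × (Fin n → ℝ) =>
      assemble p.1 p.2 := by
    simp only [assemble_eq_costs]
    exact measurable_costs_zip D n
  rw [Measure.map_apply hassemble hs.compl]
  change ∀ᵐ p ∂(Measure.pi fun _ : Fin n => boxLaw lam X).prod (timeLaw τ n),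
    ∀ q ∈ assemble p.1 p.2, IsIn X q
  filter_upwards [Measure.quasiMeasurePreserving_fst.ae hB,
    Measure.quasiMeasurePreserving_snd.ae ht] with p h1 h2
  rw [assemble_eq_costs]
  refine isIn_of_mem_costs X ?_ ?_ ?_
  · rw [List.pairwise_ofFn]
    exact fun i j hij => h2.1 i j hij
  · rw [List.forall_mem_ofFn_iff]
    exact h2.2
  · rw [List.forall_mem_ofFn_iff]
    exact h1

/-- The restriction to `X ⊆ Y` of the sequence generated on `Y` is distributed as the sequence
generated on `X`. -/
theorem map_restrictList_seqLaw (hτ : 0 < τ) (hlam : 0 < lam) {X Y : BoxIntegral.Box (Fin D)}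
    (h : X ≤ Y) : (seqLaw τ lam Y).map (restrictList X 0) = seqLaw τ lam X := by
  have hXp := isProbabilityMeasure_boxLaw hlam X
  have hYp := isProbabilityMeasure_boxLaw hlam Y
  have hU := isProbabilityMeasure_uniformTime hτ
  have hsm : Measurable fun l : List (MarkedBox D) => costs 0 (byTime l) :=
    (measurable_costs 0).comp measurable_byTime
  have hs : MeasurableSet {p : MarkedBox D | Meets X p.1} := measurable_fst (measurableSet_meets X)
  have hφ : Measurable (clipMark X) :=
    ((measurable_clip X).comp measurable_fst).prodMk measurable_snd
  have hset : {p : MarkedBox D | Meets X p.1} = {B | Meets X B} ×ˢ univ := by ext; simp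
  have hle := meetProb_le_one hlam h
  have hp : (((boxLaw lam Y).prod (uniformTime τ)).restrict {p | Meets X p.1}).map (clipMark X) =
      meetProb lam X Y • (boxLaw lam X).prod (uniformTime τ) := by
    have h1 := Measure.map_prod_map ((boxLaw lam Y).restrict {B | Meets X B}) (uniformTime τ)
      (measurable_clip X) measurable_id
    rw [map_clip_boxLaw hlam h, Measure.map_id, Measure.prod_smul_left] at h1
    rw [hset, ← Measure.prod_restrict, Measure.restrict_univ, h1]
    rfl
  have hq : ((boxLaw lam Y).prod (uniformTime τ)) {p | Meets X p.1}ᶜ =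
      ((1 - meetProb lam X Y : ℝ≥0) : ℝ≥0∞) := by
    rw [prob_compl_eq_one_sub hs, hset, Measure.prod_prod, boxLaw_meets hlam h, measure_univ,
      mul_one, ENNReal.coe_sub, ENNReal.coe_one]
  rw [seqLaw_eq_map_poissonList hτ hlam, seqLaw_eq_map_poissonList hτ hlam,
    ← meanCount_mul_meetProb hτ hlam X Y,
    ← map_thin_poissonList hs hφ hp hq (add_tsub_cancel_of_le hle),
    Measure.map_map (measurable_restrictList X 0) hsm, Measure.map_map hsm (measurable_thin hs hφ)]
  congr 1
  ext1 l
  simp only [Function.comp_apply]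
  rw [restrictList_costs, sub_zero, thin_byTime (φ := clipMark X) _ fun _ => rfl]

end SeqLaw

/-! ### The laws on the spaces of partitions -/

section Law

variable {D : ℕ} {τ lam : ℝ}

theorem measurableSet_partition (X : BoxIntegral.Box (Fin D)) :
    MeasurableSet {ω : List (MarkedBox D) | ∀ p ∈ ω, IsIn X p} :=
  measurableSet_forall_mem (measurableSet_isIn X)

theorem measurableEmbedding_val (X : BoxIntegral.Box (Fin D)) :
    MeasurableEmbedding (Subtype.val : Partition X → List (MarkedBox D)) :=
  MeasurableEmbedding.subtype_coe (measurableSet_partition X)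

theorem map_val_law (hτ : 0 < τ) (hlam : 0 < lam) (X : BoxIntegral.Box (Fin D)) :
    (law τ lam X).map Subtype.val = seqLaw τ lam X := by
  rw [law, (measurableEmbedding_val X).map_comap]
  refine Measure.restrict_eq_self_of_ae_mem ?_
  filter_upwards [ae_seqLaw_isIn hτ hlam X] with l hl
  exact ⟨⟨l, hl⟩, rfl⟩

theorem isProbabilityMeasure_law (hτ : 0 < τ) (hlam : 0 < lam) (X : BoxIntegral.Box (Fin D)) :
    IsProbabilityMeasure (law τ lam X) := by
  have := isProbabilityMeasure_seqLaw hτ hlam X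
  refine ⟨?_⟩
  have h := measure_univ (μ := seqLaw τ lam X)
  rwa [← map_val_law hτ hlam X, Measure.map_apply measurable_subtype_coe .univ,
    Set.preimage_univ] at h

theorem measurable_restrict (Y X : BoxIntegral.Box (Fin D)) : Measurable (restrict Y X) :=
  ((measurable_restrictList X 0).comp measurable_subtype_coe).subtype_mk

/-- The laws `P^X` are consistent: they form a projective family. -/
theorem map_restrict_law (hτ : 0 < τ) (hlam : 0 < lam) {X Y : BoxIntegral.Box (Fin D)}
    (h : X ≤ Y) : (law τ lam Y).map (restrict Y X) = law τ lam X := by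
  have he := measurableEmbedding_val X
  rw [← he.comap_map ((law τ lam Y).map (restrict Y X)), ← he.comap_map (law τ lam X)]
  congr 1
  rw [map_val_law hτ hlam, Measure.map_map measurable_subtype_coe (measurable_restrict Y X),
    ← map_restrictList_seqLaw hτ hlam h, ← map_val_law hτ hlam Y,
    Measure.map_map (measurable_restrictList X 0) measurable_subtype_coe]
  rfl

theorem clip_clip {X Y : BoxIntegral.Box (Fin D)} (h : X ≤ Y) (B : BoundingBox D) :
    clip X (clip Y B) = clip X B := by
  have hle := BoxIntegral.Box.le_iff_bounds.1 h
  ext d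
  · simp [clip, max_assoc, max_eq_right (hle.1 d)]
  · simp [clip, min_assoc, min_eq_right (hle.2 d)]

theorem Meets.mono {X Y : BoxIntegral.Box (Fin D)} (h : X ≤ Y) {B : BoundingBox D}
    (hB : Meets X B) : Meets Y B := by
  have hle := BoxIntegral.Box.le_iff_bounds.1 h
  intro d
  exact (max_le_max le_rfl (hle.1 d)).trans ((hB d).trans (min_le_min le_rfl (hle.2 d)))

theorem restrictList_restrictList {X Y : BoxIntegral.Box (Fin D)} (h : X ≤ Y) (c c' : ℝ)
    (ω : List (MarkedBox D)) :
    restrictList X c (restrictList Y c' ω) = restrictList X (c + c') ω := by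
  induction ω generalizing c c' with
  | nil => rfl
  | cons p ω ih =>
    have hm : Meets X (clip Y p.1) ↔ Meets X p.1 := by
      simp only [Meets, clip_clip h]
    by_cases hY : Meets Y p.1
    · by_cases hX : Meets X p.1
      · simp [restrictList, hY, hX, hm, ih, clip_clip h, add_assoc]
      · simp [restrictList, hY, hX, hm, ih, add_assoc]
    · have hX : ¬ Meets X p.1 := fun hX => hY (hX.mono h)
      simp [restrictList, hY, hX, ih, add_assoc]

theorem restrict_restrict {X Y Z : BoxIntegral.Box (Fin D)} (hXY : X ≤ Y) (ω : Partition Z) :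
    restrict Y X (restrict Z Y ω) = restrict Z X ω :=
  Subtype.ext (by simp only [restrict, restrictList_restrictList hXY, add_zero])

theorem standardBorelSpace_partition (X : BoxIntegral.Box (Fin D)) :
    StandardBorelSpace (Partition X) :=
  have := standardBorelSpace_list (α := MarkedBox D)
  (measurableSet_partition X).standardBorel

end Law

/-! ### Sequential projective limits -/

section Sequence

open Finset

/-- A consistent sequence of probability measures on standard Borel spaces is the sequence of
marginals of a random consistent sequence: a Markov chain whose transition kernels are the
conditional laws of the next term given the present one. -/
theorem exists_measure_of_consistent {Ω : ℕ → Type*} [∀ n, MeasurableSpace (Ω n)]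
    [∀ n, StandardBorelSpace (Ω n)] [∀ n, Nonempty (Ω n)] (μ : ∀ n, Measure (Ω n))
    [∀ n, IsProbabilityMeasure (μ n)] (r : ∀ n, Ω (n + 1) → Ω n) (hr : ∀ n, Measurable (r n))
    (hμ : ∀ n, (μ (n + 1)).map (r n) = μ n) :
    ∃ P : Measure (∀ n, Ω n), IsProbabilityMeasure P ∧
      (∀ n, P.map (fun x => x n) = μ n) ∧ ∀ᵐ x ∂P, ∀ n, r n (x (n + 1)) = x n := by
  let ρ : ∀ n, Measure (Ω n × Ω (n + 1)) := fun n => (μ (n + 1)).map fun y => (r n y, y)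
  have hg : ∀ n, Measurable fun y : Ω (n + 1) => (r n y, y) := fun n =>
    (hr n).prodMk measurable_id
  have hρp : ∀ n, IsProbabilityMeasure (ρ n) := fun n =>
    Measure.isProbabilityMeasure_map (hg n).aemeasurable
  have hfst : ∀ n, (ρ n).fst = μ n := fun n => by
    rw [Measure.fst, Measure.map_map measurable_fst (hg n), ← hμ n]; rfl
  have hlast : ∀ n, Measurable (fun x => x ⟨n, mem_Iic.2 le_rfl⟩ : (∀ i : Iic n, Ω i) → Ω n) :=
    fun n => measurable_pi_apply (X := fun i : Iic n => Ω i) ⟨n, mem_Iic.2 le_rfl⟩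
  let κ : ∀ n, Kernel (∀ i : Iic n, Ω i) (Ω (n + 1)) := fun n =>
    (ρ n).condKernel.comap _ (hlast n)
  let P := Kernel.trajMeasure (μ 0) κ
  -- If the `n`-th marginal is `μ n`, the joint law of two successive terms is that of `(r y, y)`.
  have hstep : ∀ n, P.map (fun x => x n) = μ n → P.map (fun x => (x n, x (n + 1))) = ρ n := by
    intro n hn
    have h := Kernel.map_frestrictLe_trajMeasure_compProd_eq_map_trajMeasure (μ₀ := μ 0) (κ := κ)
      (a := n)
    have hg' : Measurable (fun q => (q.1 ⟨n, mem_Iic.2 le_rfl⟩, q.2) :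
        (∀ i : Iic n, Ω i) × Ω (n + 1) → Ω n × Ω (n + 1)) :=
      ((hlast n).comp measurable_fst).prodMk measurable_snd
    have h1 := congrArg (fun ν => ν.map fun q => (q.1 ⟨n, mem_Iic.2 le_rfl⟩, q.2)) h
    simp only at h1
    rw [Measure.map_map hg' (by fun_prop)] at h1
    refine h1.symm.trans ?_
    have hν : (P.map (Preorder.frestrictLe n)).map (fun x => x ⟨n, mem_Iic.2 le_rfl⟩) = μ n := by
      rw [Measure.map_map (hlast n) (by fun_prop), ← hn]; rfl
    refine Measure.ext_of_lintegral _ fun f hf => ?_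
    rw [lintegral_map hf hg', Measure.lintegral_compProd
      (f := fun q : (∀ i : Iic n, Ω i) × Ω (n + 1) => f (q.1 ⟨n, mem_Iic.2 le_rfl⟩, q.2))
      (hf.comp hg')]
    conv_rhs => rw [← (ρ n).disintegrate (ρ n).condKernel, Measure.lintegral_compProd hf, hfst,
      ← hν]
    rw [lintegral_map hf.lintegral_kernel_prod_right' (hlast n)]
    rfl
  have hmarg : ∀ n, P.map (fun x => x n) = μ n := by
    intro n
    induction n with
    | zero =>
      have h : P.map (Preorder.frestrictLe 0) =
          (μ 0).map (MeasurableEquiv.piUnique fun i : Iic 0 => Ω i).symm := by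
        simp only [P]
        rw [Kernel.trajMeasure, Measure.map_comp _ _ (by fun_prop), Kernel.traj_map_frestrictLe,
          Kernel.partialTraj_self, Measure.id_comp]
        rfl
      calc P.map (fun x => x 0)
          = (P.map (Preorder.frestrictLe 0)).map (fun x => x ⟨0, mem_Iic.2 le_rfl⟩) :=
            (Measure.map_map (hlast 0) (Preorder.measurable_frestrictLe 0)).symm
        _ = ((μ 0).map (MeasurableEquiv.piUnique fun i : Iic 0 => Ω i).symm).map
              (fun x => x ⟨0, mem_Iic.2 le_rfl⟩) := by rw [h]
        _ = μ 0 := (Measure.map_map (hlast 0)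
            (MeasurableEquiv.piUnique fun i : Iic 0 => Ω i).symm.measurable).trans Measure.map_id
    | succ n ih =>
      have h := congrArg (fun ν => ν.map Prod.snd) (hstep n ih)
      simp only [ρ] at h
      rw [Measure.map_map measurable_snd (by fun_prop), Measure.map_map measurable_snd (hg n)] at h
      simpa [Function.comp_def] using h
  refine ⟨P, inferInstance, hmarg, ?_⟩
  rw [ae_all_iff]
  intro n
  have hm : MeasurableSet {p : Ω n × Ω (n + 1) | r n p.2 = p.1} :=
    measurableSet_eq_fun ((hr n).comp measurable_snd) measurable_fst
  have h1 : ∀ᵐ p ∂ρ n, r n p.2 = p.1 := by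
    rw [ae_map_iff (hg n).aemeasurable hm]
    exact ae_of_all _ fun _ => rfl
  rw [← hstep n (hmarg n), ae_map_iff (by fun_prop) hm] at h1
  exact h1

end Sequence

/-! ### The projective limit -/

section Limit

variable {D : ℕ} {τ lam : ℝ}

/-- The box `(-(n + 1), n + 1]^D`. -/
def cube (D n : ℕ) : BoxIntegral.Box (Fin D) where
  lower _ := -(n + 1)
  upper _ := n + 1
  lower_lt_upper _ := by
    have : (0 : ℝ) < n + 1 := by positivity
    linarith

theorem cube_mono (D : ℕ) : Monotone (cube D) := by
  intro m n h
  have h' : (m : ℝ) ≤ n := by exact_mod_cast h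
  rw [BoxIntegral.Box.le_iff_bounds]
  refine ⟨fun d => ?_, fun d => ?_⟩ <;> simp only [cube] <;> linarith

theorem exists_le_cube (X : BoxIntegral.Box (Fin D)) : ∃ n, X ≤ cube D n := by
  obtain ⟨n, hn⟩ := exists_nat_ge (∑ d, (|X.lower d| + |X.upper d|))
  refine ⟨n, BoxIntegral.Box.le_iff_bounds.2 ⟨fun d => ?_, fun d => ?_⟩⟩
  all_goals
    have h := (Finset.single_le_sum (f := fun d => |X.lower d| + |X.upper d|)
      (fun d _ => by positivity) (Finset.mem_univ d)).trans hn
    have h1 := abs_nonneg (X.lower d)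
    have h2 := abs_nonneg (X.upper d)
    have h3 := neg_abs_le (X.lower d)
    have h4 := le_abs_self (X.upper d)
    simp only [cube] at h ⊢
    linarith

theorem measurable_proj (X : BoxIntegral.Box (Fin D)) : Measurable (proj X) :=
  (measurable_pi_apply X).comp measurable_subtype_coe

/-- A probability measure on the projective limit is determined by its images under the
projections: the domains are directed, so that the events that depend on a single domain form a
π-system. -/
theorem ext_of_map_proj {P Q : Measure (Limit D)} [IsFiniteMeasure P]
    (h : ∀ X, P.map (proj X) = Q.map (proj X)) : P = Q := by
  let C : Set (Set (Limit D)) := {s | ∃ X A, MeasurableSet A ∧ proj X ⁻¹' A = s}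
  have hC : IsPiSystem C := by
    rintro _ ⟨X, A, hA, rfl⟩ _ ⟨Y, B, hB, rfl⟩ -
    refine ⟨X ⊔ Y, restrict (X ⊔ Y) X ⁻¹' A ∩ restrict (X ⊔ Y) Y ⁻¹' B,
      (measurable_restrict _ _ hA).inter (measurable_restrict _ _ hB), ?_⟩
    ext ω
    simp only [Set.mem_preimage, Set.mem_inter_iff, proj, ω.2 X _ le_sup_left,
      ω.2 Y _ le_sup_right]
  have hgen : (inferInstance : MeasurableSpace (Limit D)) = MeasurableSpace.generateFrom C := by
    refine le_antisymm ?_ (MeasurableSpace.generateFrom_le ?_)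
    · have hle : MeasurableSpace.pi ≤
          (MeasurableSpace.generateFrom C).map (Subtype.val : Limit D → _) := by
        refine iSup_le fun X => ?_
        rintro _ ⟨A, hA, rfl⟩
        exact MeasurableSpace.measurableSet_generateFrom ⟨X, A, hA, rfl⟩
      exact MeasurableSpace.comap_le_iff_le_map.2 hle
    · rintro _ ⟨X, A, hA, rfl⟩
      exact measurable_proj X hA
  have hset : ∀ X A, MeasurableSet A → P (proj X ⁻¹' A) = Q (proj X ⁻¹' A) := fun X A hA => by
    rw [← Measure.map_apply (measurable_proj X) hA, h X, Measure.map_apply (measurable_proj X) hA]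
  refine ext_of_generate_finite C hgen hC ?_ ?_
  · rintro _ ⟨X, A, hA, rfl⟩
    exact hset X A hA
  · exact hset (cube D 0) Set.univ .univ

/-- A sequence of partitions of the cubes that is consistent under restriction extends to a
consistent family over all boxes. -/
noncomputable def limitOfSeq (x : ∀ n, Partition (cube D n))
    (hx : ∀ n, restrict (cube D (n + 1)) (cube D n) (x (n + 1)) = x n) : Limit D :=
  ⟨fun X => restrict _ X (x (exists_le_cube X).choose), by
    have hmn : ∀ m n, m ≤ n → restrict (cube D n) (cube D m) (x n) = x m := by
      intro m n hmn
      induction n, hmn using Nat.le_induction with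
      | base =>
        rw [← hx m, restrict_restrict le_rfl]
      | succ n hmn ih => rw [← ih, ← hx n, restrict_restrict (cube_mono D hmn)]
    have key : ∀ (X : BoxIntegral.Box (Fin D)) m n, X ≤ cube D m → m ≤ n →
        restrict _ X (x m) = restrict _ X (x n) := fun X m n hX h => by
      rw [← hmn m n h, restrict_restrict hX]
    intro X Y hXY
    rw [restrict_restrict hXY]
    exact (key X _ _ (hXY.trans (exists_le_cube Y).choose_spec) (le_max_right _ _)).trans
      (key X _ _ (exists_le_cube X).choose_spec (le_max_left _ _)).symm⟩

theorem exists_measure_limit (hτ : 0 < τ) (hlam : 0 < lam) :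
    ∃ P : Measure (Limit D), IsProbabilityMeasure P ∧ ∀ X, P.map (proj X) = law τ lam X := by
  classical
  have hstd : ∀ n, StandardBorelSpace (Partition (cube D n)) := fun n =>
    standardBorelSpace_partition _
  have hne : ∀ n, Nonempty (Partition (cube D n)) := fun n => ⟨⟨[], by simp⟩⟩
  have hprob : ∀ n, IsProbabilityMeasure (law τ lam (cube D n)) := fun n =>
    isProbabilityMeasure_law hτ hlam _
  obtain ⟨P, hP, hmarg, hcons⟩ := exists_measure_of_consistent
    (fun n => law τ lam (cube D n)) (fun n => restrict (cube D (n + 1)) (cube D n))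
    (fun n => measurable_restrict _ _)
    fun n => map_restrict_law hτ hlam (cube_mono D n.le_succ)
  let good : Set (∀ n, Partition (cube D n)) :=
    {x | ∀ n, restrict (cube D (n + 1)) (cube D n) (x (n + 1)) = x n}
  have hgood : MeasurableSet good := by
    have : good = ⋂ n, {x | restrict (cube D (n + 1)) (cube D n) (x (n + 1)) = x n} := by
      ext x; simp [good]
    rw [this]
    exact MeasurableSet.iInter fun n => measurableSet_eq_fun
      ((measurable_restrict _ _).comp (measurable_pi_apply _)) (measurable_pi_apply _)
  -- On the null event of inconsistent sequences, take empty partitions.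
  let Φ : (∀ n, Partition (cube D n)) → Limit D := fun x =>
    if hx : x ∈ good then limitOfSeq x hx else ⟨fun X => ⟨[], by simp⟩, fun _ _ _ => rfl⟩
  have hproj : ∀ X, (fun x => proj X (Φ x)) = fun x =>
      if x ∈ good then restrict _ X (x (exists_le_cube X).choose) else ⟨[], by simp⟩ := by
    intro X
    ext1 x
    by_cases hx : x ∈ good
    · simp only [Φ, dif_pos hx, if_pos hx]; rfl
    · simp only [Φ, dif_neg hx, if_neg hx]; rfl
  have hr : ∀ X : BoxIntegral.Box (Fin D), Measurable fun x : ∀ n, Partition (cube D n) =>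
      restrict _ X (x (exists_le_cube X).choose) := fun X =>
    (measurable_restrict _ X).comp (measurable_pi_apply _)
  have hΦ : Measurable Φ := by
    refine Measurable.subtype_mk (f := fun x => (Φ x).1) (measurable_pi_lambda _ fun X => ?_)
    change Measurable fun x => proj X (Φ x)
    rw [hproj X]
    exact Measurable.ite hgood (hr X) measurable_const
  refine ⟨P.map Φ, Measure.isProbabilityMeasure_map hΦ.aemeasurable, fun X => ?_⟩
  rw [Measure.map_map (measurable_proj X) hΦ]
  have h1 : proj X ∘ Φ =ᵐ[P] fun x => restrict _ X (x (exists_le_cube X).choose) := by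
    filter_upwards [hcons] with x hx
    have := congrFun (hproj X) x
    rw [if_pos (show x ∈ good from hx)] at this
    exact this
  rw [Measure.map_congr h1, ← map_restrict_law hτ hlam (exists_le_cube X).choose_spec, ← hmarg]
  exact (Measure.map_map (measurable_restrict _ X)
    (measurable_pi_apply (exists_le_cube X).choose)).symm

end Limit

end RBP

theorem theorem1 (D : ℕ) (τ lam : ℝ) (hτ : 0 < τ) (hlam : 0 < lam) :
    ∃! P : MeasureTheory.Measure (RBP.Limit D),
      MeasureTheory.IsProbabilityMeasure P ∧
        ∀ X : BoxIntegral.Box (Fin D), P.map (RBP.proj X) = RBP.law τ lam X := by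
  obtain ⟨P, hP, hlaw⟩ := RBP.exists_measure_limit (D := D) hτ hlam
  refine ⟨P, ⟨hP, hlaw⟩, fun Q hQ => ?_⟩
  have := hQ.1
  exact RBP.ext_of_map_proj fun X => (hQ.2 X).trans (hlaw X).symm
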